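/- Let $d\ge 2$. For $q\in\mathbb R$ let $\Delta_q(X)=qX+(1-q)\,\mathrm{Tr}(X)\,\mathbb 1/d$ be the depolarizing map on complex $d\times d$ matrices. A linear map on matrices is *positive* if it sends positive semidefinite matrices to positive semidefinite matrices. A matrix on $\mathbb C^d\otimes\mathbb C^d$ is *separable* if it is a finite sum $\sum_i A_i\otimes B_i$ with all $A_i,B_i$ positive semidefinite. A map $\Xi$ on the bipartite system $\mathbb C^d\otimes\mathbb C^d$ is *entanglement-annihilating* if it is positive and $\Xi(R)$ is separable for every state $R$ (positive semidefinite matrix of trace one), and *PPT-inducing* if $(I\otimes T)\,\Xi$ is positive, where $T$ is transposition. 1. $\Delta_q$ is positive iff $-\frac1{d-1}\le q\le 1$. For all $q_1,q_2\in\mathbb R$, the product $\Delta_{q_1}\otimes\Delta_{q_2}$ is positive iff $\Delta_{q_1}$ and $\Delta_{q_2}$ are positive and $(d^2-1)\,q_1q_2\ge -1$. 2. For all $q_1,q_2\in\mathbb R$, $\Delta_{q_1}\otimes\Delta_{q_2}$ is entanglement-annihilating iff it is positive and $$(d^2+2d-2)\,q_1q_2\le 2+(d-2)(q_1+q_2).\qquad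 (*)$$ In particular, if $-\frac1{d^2-1}\le q_1,q_2\le 1$, then $\Delta_{q_1}\otimes\Delta_{q_2}$ is entanglement-annihilating iff $(*)$ holds. 3. For $q_1=q_2=q\in\mathbb R$, $(*)$ is equivalent to $$-\frac{\sqrt3-1}{d+1-\sqrt3}\le q\le\frac{1+\sqrt3}{d+1+\sqrt3},\qquad(**)$$ and $\Delta_q\otimes\Delta_q$ is entanglement-annihilating iff $(**)$ holds. If $\Delta_q$ is positive, then $\Delta_q\otimes\Delta_q$ is PPT-inducing iff $(**)$ holds. 4. If $-\frac1{d^2-1}\le q\le 1$, then each of the conditions "$\Delta_q\otimes\Delta_q$ is entanglement-annihilating" and "$\Delta_q\otimes\Delta_q$ is PPT-inducing" is equivalent to $q\le\frac{1+\sqrt3}{d+1+\sqrt3}$. -/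

import Mathlib

open scoped Kronecker ComplexOrder

namespace Depolarizing

noncomputable section

/-- Square complex matrices indexed by `m`, i.e. operators on a system with basis `m`. -/
abbrev Op (m : Type) : Type := Matrix m m ℂ

/-- The tensor product `Φ ⊗ Ψ` of two linear maps on matrix spaces, as a linear map on matrices
of the bipartite system; the identification of `M_m ⊗ M_n` with `M_{m × n}` is
Mathlib's Kronecker isomorphism. -/
def tensorMap {m n : Type} [Fintype m] [DecidableEq m] [Fintype n] [DecidableEq n]
    (Φ : Op m →ₗ[ℂ] Op m) (Ψ : Op n →ₗ[ℂ] Op n) : Op (m × n) →ₗ[ℂ] Op (m × n) :=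
  (kroneckerLinearEquiv m m n n ℂ).conj (TensorProduct.map Φ Ψ)

theorem tensorMap_kronecker {m n : Type} [Fintype m] [DecidableEq m] [Fintype n] [DecidableEq n]
    (Φ : Op m →ₗ[ℂ] Op m) (Ψ : Op n →ₗ[ℂ] Op n) (A : Op m) (B : Op n) :
    tensorMap Φ Ψ (A ⊗ₖ B) = Φ A ⊗ₖ Ψ B := by
  simp [tensorMap, LinearEquiv.conj_apply]

/-- A linear map on matrices is positive if it sends positive semidefinite matrices to positive
semidefinite matrices. -/
def IsPositiveMap {m : Type} (Φ : Op m →ₗ[ℂ] Op m) : Prop :=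
  ∀ X : Op m, X.PosSemidef → (Φ X).PosSemidef

/-- A (quantum) state: a positive semidefinite matrix of trace one. -/
def IsState {m : Type} [Fintype m] (R : Op m) : Prop :=
  R.PosSemidef ∧ R.trace = 1

/-- The convex cone of separable matrices of a bipartite system: finite sums of Kronecker products
of positive semidefinite matrices. A matrix of trace one lies in it exactly when it is a convex
combination of product states. -/
def IsSeparable {m n : Type} (M : Op (m × n)) : Prop :=
  ∃ (k : ℕ) (A : Fin k → Op m) (B : Fin k → Op n),
    (∀ i, (A i).PosSemidef) ∧ (∀ i, (B i).PosSemidef) ∧ M = ∑ i, A i ⊗ₖ B i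

/-- An entanglement-annihilating map: a positive map on a bipartite system whose output on every
input state is separable (across the cut between the two subsystems). -/
def IsEntanglementAnnihilating {m n : Type} [Fintype m] [Fintype n]
    (Φ : Op (m × n) →ₗ[ℂ] Op (m × n)) : Prop :=
  IsPositiveMap Φ ∧ ∀ R : Op (m × n), IsState R → IsSeparable (Φ R)

/-- The partial transposition `I ⊗ T` on the second subsystem. -/
def partialTranspose (m n : Type) [Fintype m] [DecidableEq m] [Fintype n] [DecidableEq n] :
    Op (m × n) →ₗ[ℂ] Op (m × n) :=
  tensorMap LinearMap.id (Matrix.transposeLinearEquiv n n ℂ ℂ).toLinearMap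

/-- A map on a bipartite system is PPT-inducing if its composition with the partial transposition
is positive. -/
def IsPPTInducing {m n : Type} [Fintype m] [DecidableEq m] [Fintype n] [DecidableEq n]
    (Φ : Op (m × n) →ₗ[ℂ] Op (m × n)) : Prop :=
  IsPositiveMap (partialTranspose m n ∘ₗ Φ)

/-- The depolarizing map `Δ_q(X) = q X + (1 - q) (Tr X) 𝟙 / d` on `d × d` complex matrices. -/
def depolarizing (d : ℕ) (q : ℝ) : Op (Fin d) →ₗ[ℂ] Op (Fin d) :=
  (q : ℂ) • LinearMap.id +
    ((1 - (q : ℂ)) / (d : ℂ)) •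
      (Matrix.traceLinearMap (Fin d) ℂ ℂ).smulRight (1 : Op (Fin d))

theorem depolarizing_apply (d : ℕ) (q : ℝ) (X : Op (Fin d)) :
    depolarizing d q X =
      (q : ℂ) • X + ((1 - (q : ℂ)) / (d : ℂ)) • (X.trace • (1 : Op (Fin d))) := by
  simp [depolarizing]

/-- The product `Δ_p ⊗ Δ_q` of local depolarizing maps on a `d × d` bipartite system. -/
def localDepolarizing (d : ℕ) (p q : ℝ) :
    Op (Fin d × Fin d) →ₗ[ℂ] Op (Fin d × Fin d) :=
  tensorMap (depolarizing d p) (depolarizing d q)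

end

end Depolarizing

namespace Depolarizing

open Matrix

/-! ### Separable cone and partial transposition -/

section Cones

variable {m n : Type}

/-! Positive semidefinite matrices and separable matrices both form convex cones, so by the spectral
theorem it is enough to study outputs on pure states. The maps commute with conjugation by local
unitaries, and the singular value decomposition turns every unit vector into a Schmidt vector `∑ v i
|ii⟩` with `v ≥ 0` and `∑ v i ^ 2 = 1`.

Put `P = (1-p)/d`, `Q = (1-q)/d`, `s = pQ + qP`, `c = PQ`, `g = pq`. The output on a Schmidt vector
is a block `N = diag(s v i ^ 2 + c) + g v vᵀ` on the span of the `|ii⟩`, plus diagonal entries `D i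
k` on `|ik⟩`, `i ≠ k`. The main step (`mem_blockCone_of_affine`) writes `N` as a sum of `z zᵀ` with
real `z` such that contributions to an off-diagonal entry never cancel: `∑ |z i||z k| = |g| v i v
k`. The positivity conditions suffice for this, so the block is positive semidefinite, and `D ≥ 0`
gives positivity of the map.

For separability, each `z zᵀ` is completed to a separable matrix by averaging product vectors over
random phases (`isSeparable_schmidtForm_vecMulVec`). The price is diagonal weight `|z i||z k| r i /
r k` on `|ik⟩`, with `r > 0` free. Absence of cancellation makes the total price `|g| v i v k (r i /
r k)`. Since `D i k ≥ α v i ^ 2 + β v k ^ 2` with `α + β = s + 2c`, weighted AM-GM and a suitable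
`r` pay for it as soon as `|g| ≤ s + 2c`. Positivity gives `-g ≤ s + 2c`, and `g ≤ s + 2c` is
exactly the annihilation inequality.

Conversely, a separable output has positive partial transpose. Applying this to `(|00⟩ + |11⟩)/√2`
and testing on `|01⟩ - |10⟩` returns `g ≤ s + 2c`. The same test serves the PPT statement, and the
symmetric case factors the resulting quadratic in `q`. -/

theorem kronecker_induction [Fintype m] [DecidableEq m] [Fintype n] [DecidableEq n]
    {P : Op (m × n) → Prop} (hk : ∀ (A : Op m) (B : Op n), P (A ⊗ₖ B))
    (hadd : ∀ X Y, P X → P Y → P (X + Y)) (X : Op (m × n)) : P X := by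
  obtain ⟨t, rfl⟩ := (kroneckerLinearEquiv m m n n ℂ).surjective X
  induction t with
  | zero => simpa using hk 0 0
  | tmul A B => simpa using hk A B
  | add x y hx hy => rw [map_add]; exact hadd _ _ hx hy

theorem IsSeparable.of_fintype {ι : Type} [Fintype ι] (A : ι → Op m) (B : ι → Op n)
    (hA : ∀ i, (A i).PosSemidef) (hB : ∀ i, (B i).PosSemidef) :
    IsSeparable (∑ i, A i ⊗ₖ B i) := by
  refine ⟨Fintype.card ι, A ∘ (Fintype.equivFin ι).symm, B ∘ (Fintype.equivFin ι).symm,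
    fun i => hA _, fun i => hB _, ?_⟩
  exact ((Fintype.equivFin ι).symm.sum_comp fun i => A i ⊗ₖ B i).symm

theorem IsSeparable.zero : IsSeparable (0 : Op (m × n)) :=
  ⟨0, fun _ => 0, fun _ => 0, fun i => i.elim0, fun i => i.elim0, by simp⟩

theorem IsSeparable.add {M N : Op (m × n)} (hM : IsSeparable M) (hN : IsSeparable N) :
    IsSeparable (M + N) := by
  obtain ⟨k, A, B, hA, hB, rfl⟩ := hM
  obtain ⟨l, A', B', hA', hB', rfl⟩ := hN
  have := IsSeparable.of_fintype (Sum.elim A A') (Sum.elim B B')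
    (by rintro (i | i) <;> simp [hA, hA']) (by rintro (i | i) <;> simp [hB, hB'])
  simpa [Fintype.sum_sum_type] using this

theorem IsSeparable.smul {M : Op (m × n)} (hM : IsSeparable M) {t : ℝ} (ht : 0 ≤ t) :
    IsSeparable ((t : ℂ) • M) := by
  obtain ⟨k, A, B, hA, hB, rfl⟩ := hM
  refine ⟨k, fun i => (t : ℂ) • A i, B, fun i => (hA i).smul (by exact_mod_cast ht), hB, ?_⟩
  simp [Finset.smul_sum, smul_kronecker]

theorem IsSeparable.conj [Fintype m] [Fintype n] {M : Op (m × n)} (hM : IsSeparable M) (U : Op m) (V : Op n) :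
    IsSeparable ((U ⊗ₖ V) * M * (U ⊗ₖ V)ᴴ) := by
  obtain ⟨k, A, B, hA, hB, rfl⟩ := hM
  refine ⟨k, fun i => U * A i * Uᴴ, fun i => V * B i * Vᴴ,
    fun i => (hA i).mul_mul_conjTranspose_same U, fun i => (hB i).mul_mul_conjTranspose_same V, ?_⟩
  simp [Finset.mul_sum, Finset.sum_mul, mul_kronecker_mul, conjTranspose_kronecker]

variable [Fintype m] [DecidableEq m] [Fintype n] [DecidableEq n]

theorem partialTranspose_kronecker (A : Op m) (B : Op n) :
    partialTranspose m n (A ⊗ₖ B) = A ⊗ₖ Bᵀ := by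
  simp [partialTranspose, tensorMap_kronecker]

theorem partialTranspose_apply (X : Op (m × n)) (i j : m) (k l : n) :
    partialTranspose m n X (i, k) (j, l) = X (i, l) (j, k) := by
  induction X using kronecker_induction with
  | hk A B => simp [partialTranspose_kronecker]
  | hadd X Y hX hY => simp [map_add, hX, hY]

theorem IsSeparable.posSemidef_partialTranspose {M : Op (m × n)} (hM : IsSeparable M) :
    (partialTranspose m n M).PosSemidef := by
  obtain ⟨k, A, B, hA, hB, rfl⟩ := hM
  rw [map_sum]
  refine posSemidef_sum _ fun i _ => ?_
  rw [partialTranspose_kronecker]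
  exact (hA i).kronecker (hB i).transpose

end Cones

/-! ### Reduction to pure states and the singular value decomposition -/

section Spectral

variable {n : Type} [Fintype n] [DecidableEq n]

theorem posSemidef_eq_sum_vecMulVec {X : Op n} (hX : X.PosSemidef) :
    ∃ (μ : n → ℝ) (u : n → n → ℂ), (∀ k, 0 ≤ μ k) ∧ (∀ k, ∑ i, ‖u k i‖ ^ 2 = 1) ∧
      X = ∑ k, (μ k : ℂ) • vecMulVec (u k) (star (u k)) := by
  refine ⟨hX.1.eigenvalues, fun k => hX.1.eigenvectorBasis k, hX.eigenvalues_nonneg, ?_, ?_⟩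
  · intro k
    have := hX.1.eigenvectorBasis.orthonormal.1 k
    rw [EuclideanSpace.norm_eq, Real.sqrt_eq_one] at this
    exact this
  · conv_lhs => rw [hX.1.spectral_theorem, Unitary.conjStarAlgAut_apply]
    ext i j
    simp only [mul_apply, diagonal_apply, Matrix.sum_apply, Matrix.smul_apply]
    refine Finset.sum_congr rfl fun k _ => ?_
    simp [vecMulVec_apply, star_apply]
    ring

/-- The predicate is left abstract so that one reduction to pure states serves both the positive
semidefinite cone and the separable cone. -/
theorem cone_of_unit_vectors {m : Type} {P : Op m → Prop} (h0 : P 0)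
    (hadd : ∀ X Y, P X → P Y → P (X + Y)) (hsmul : ∀ (t : ℝ) X, 0 ≤ t → P X → P ((t : ℂ) • X))
    (Φ : Op n →ₗ[ℂ] Op m)
    (hΦ : ∀ u : n → ℂ, ∑ i, ‖u i‖ ^ 2 = 1 → P (Φ (vecMulVec u (star u))))
    {X : Op n} (hX : X.PosSemidef) : P (Φ X) := by
  obtain ⟨μ, u, hμ, hu, rfl⟩ := posSemidef_eq_sum_vecMulVec hX
  rw [map_sum]
  refine Finset.sum_induction _ P hadd h0 fun k _ => ?_
  rw [map_smul]
  exact hsmul _ _ (hμ k) (hΦ _ (hu k))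

/-- The singular value decomposition of a square complex matrix. -/
theorem exists_singularValueDecomposition (A : Op n) :
    ∃ U ∈ unitaryGroup n ℂ, ∃ V ∈ unitaryGroup n ℂ, ∃ v : n → ℝ, (∀ i, 0 ≤ v i) ∧
      A = U * diagonal (fun i => (v i : ℂ)) * V := by
  have hH : (Aᴴ * A).PosSemidef := posSemidef_conjTranspose_mul_self A
  set W := hH.1.eigenvectorUnitary
  set μ := hH.1.eigenvalues
  have hμ : ∀ i, 0 ≤ μ i := hH.eigenvalues_nonneg
  set C : Op n := A * (W : Op n) with hC
  have hCC : Cᴴ * C = diagonal (fun i => (μ i : ℂ)) := by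
    have := hH.1.conjStarAlgAut_star_eigenvectorUnitary
    rw [Unitary.conjStarAlgAut_star_apply] at this
    rw [hC, conjTranspose_mul]
    simpa [Matrix.mul_assoc, star_eq_conjTranspose, Function.comp_def] using! this
  have hcol : ∀ i j, ∑ k, star (C k i) * C k j = if i = j then (μ i : ℂ) else 0 := by
    intro i j
    have := congrFun (congrFun hCC i) j
    simpa [mul_apply, diagonal_apply] using this
  -- The columns of `C` are orthogonal with squared norms `μ i`. The nonzero ones are normalised and
  -- extended to an orthonormal basis; where `μ i = 0` the column vanishes, so the added basis
  -- vector is immaterial.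
  let w : n → EuclideanSpace ℂ n := fun i => WithLp.toLp 2 fun k => ((√(μ i))⁻¹ : ℂ) * C k i
  have hw : Orthonormal ℂ (Set.domRestrict {i | μ i ≠ 0} w) := by
    rw [orthonormal_iff_ite]
    rintro ⟨i, hi⟩ ⟨j, hj⟩
    have hi' : ((√(μ i) : ℝ) : ℂ) ≠ 0 := by
      simpa [Real.sqrt_eq_zero (hμ i)] using hi
    have e : inner ℂ (w i) (w j) = ((√(μ i))⁻¹ : ℂ) * ((√(μ j))⁻¹ : ℂ) *
        ∑ k, star (C k i) * C k j := by
      simp only [w, PiLp.inner_apply, Finset.mul_sum]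
      refine Finset.sum_congr rfl fun k _ => ?_
      simp
      ring
    simp only [Set.domRestrict_apply, Subtype.mk.injEq]
    rw [e, hcol]
    split_ifs with h
    · subst h
      have : (μ i : ℂ) = (√(μ i) : ℂ) * (√(μ i) : ℂ) := by
        rw [← Complex.ofReal_mul, Real.mul_self_sqrt (hμ i)]
      rw [this]
      field_simp
    · simp
  obtain ⟨b, hb⟩ := hw.exists_orthonormalBasis_extension_of_card_eq (by simp)
  let U : Op n := (EuclideanSpace.basisFun n ℂ).toBasis.toMatrix b.toBasis
  have hU : U ∈ unitaryGroup n ℂ :=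
    (EuclideanSpace.basisFun n ℂ).toMatrix_orthonormalBasis_mem_unitary b
  refine ⟨U, hU, (star W : unitaryGroup n ℂ), (star W).2, fun i => √(μ i),
    fun i => Real.sqrt_nonneg _, ?_⟩
  have hCU : C = U * diagonal (fun i => (√(μ i) : ℂ)) := by
    ext k i
    rw [mul_diagonal]
    have hUk : U k i = b i k := by
      simp [U, Module.Basis.toMatrix_apply]
    rw [hUk]
    by_cases hi : μ i = 0
    · have h1 := hcol i i
      rw [if_pos rfl, hi] at h1
      have h2 : ∑ k, ‖C k i‖ ^ 2 = 0 := by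
        have : ((∑ k, ‖C k i‖ ^ 2 : ℝ) : ℂ) = 0 := by
          rw [← Complex.ofReal_zero, ← h1]
          push_cast
          refine Finset.sum_congr rfl fun k _ => ?_
          rw [Complex.star_def, Complex.conj_mul']
        exact_mod_cast this
      rw [Finset.sum_eq_zero_iff_of_nonneg (fun _ _ => by positivity)] at h2
      have := h2 k (Finset.mem_univ k)
      simp only [hi]
      simpa using this
    · rw [hb i hi]
      have hi' : ((√(μ i) : ℝ) : ℂ) ≠ 0 := by
        simpa [Real.sqrt_eq_zero (hμ i)] using hi
      simp only [w]
      field_simp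
  rw [← hCU, hC, Matrix.mul_assoc]
  simp

end Spectral

/-! ### Decomposing a diagonal plus a rank-one matrix without cancellation -/

section BlockCone

/-- The cone generated by the pairs `(z zᵀ, |z| |z|ᵀ)` for real vectors `z`. -/
def blockCone (ι : Type) : AddSubmonoid (Matrix ι ι ℝ × Matrix ι ι ℝ) :=
  AddSubmonoid.closure (Set.range fun z : ι → ℝ =>
    (vecMulVec z z, vecMulVec (fun i => |z i|) (fun i => |z i|)))

theorem sum_mem_blockCone {ι κ : Type} [Fintype κ] (z : κ → ι → ℝ) {N B : Matrix ι ι ℝ}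
    (hN : ∀ i j, N i j = ∑ k, z k i * z k j) (hB : ∀ i j, B i j = ∑ k, |z k i| * |z k j|) :
    (N, B) ∈ blockCone ι := by
  have : (N, B) = ∑ k, (vecMulVec (z k) (z k),
      vecMulVec (fun i => |z k i|) (fun i => |z k i|)) := by
    ext i j
    · simp [Prod.fst_sum, Matrix.sum_apply, vecMulVec_apply, hN]
    · simp [Prod.snd_sum, Matrix.sum_apply, vecMulVec_apply, hB]
  rw [this]
  exact sum_mem fun k _ => AddSubmonoid.subset_closure ⟨z k, rfl⟩

variable {ι : Type} [Fintype ι] [DecidableEq ι]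

theorem diagonal_mem_blockCone {F : ι → ℝ} (hF : ∀ i, 0 ≤ F i) :
    (diagonal F, diagonal F) ∈ blockCone ι := by
  refine sum_mem_blockCone (fun k => Pi.single k (√(F k))) ?_ ?_ <;>
  · intro i j
    rw [Finset.sum_eq_single i]
    · by_cases h : i = j
      · subst h
        simp [abs_of_nonneg (Real.sqrt_nonneg _), Real.mul_self_sqrt (hF i)]
      · simp [h, Ne.symm h]
    · intro k _ hk
      simp [Pi.single_apply, hk.symm]
    · simp

theorem vecMulVec_mem_blockCone {ι : Type} {g : ℝ} (hg : 0 ≤ g) {w : ι → ℝ} (hw : ∀ i, 0 ≤ w i) :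
    (g • vecMulVec w w, g • vecMulVec w w) ∈ blockCone ι := by
  refine sum_mem_blockCone (κ := Unit) (fun _ i => √g * w i) ?_ ?_ <;>
  · intro i j
    have := Real.mul_self_sqrt hg
    simp only [Matrix.smul_apply, vecMulVec_apply, smul_eq_mul, Finset.univ_unique,
      Finset.sum_const, Finset.card_singleton, one_smul, abs_mul, abs_of_nonneg (hw _),
      abs_of_nonneg (Real.sqrt_nonneg g)]
    linear_combination -(w i * w j) * this

/-- A nonnegative rank-one matrix perturbed by a nonnegative diagonal. -/
theorem blockCone_of_diagonal_nonneg {g : ℝ} (hg : 0 ≤ g) {F v : ι → ℝ} (hv : ∀ i, 0 ≤ v i)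
    (hF : ∀ i, 0 ≤ F i) :
    ∃ B, (diagonal F + g • vecMulVec v v, B) ∈ blockCone ι ∧
      ∀ i j, i ≠ j → B i j = |g| * (v i * v j) :=
  ⟨_, add_mem (diagonal_mem_blockCone hF) (vecMulVec_mem_blockCone hg hv), fun i j h => by
    simp [diagonal_apply_ne _ h, vecMulVec_apply, abs_of_nonneg hg]⟩

/-- A nonnegative rank-one matrix perturbed by a diagonal with one negative entry. -/
theorem blockCone_of_diagonal_neg {g : ℝ} (hg : 0 ≤ g) {F v κ : ι → ℝ} (m : ι)
    (hv : ∀ i, 0 ≤ v i) (hF : ∀ i, i ≠ m → 0 ≤ F i) (hκ : ∀ i, i ≠ m → 0 ≤ κ i)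
    (hκm : κ m = 0) (hFκ : ∀ i, i ≠ m → F i * κ i = v i ^ 2)
    (hm : 0 ≤ F m * (1 + g * ∑ i, κ i) + g * v m ^ 2) :
    ∃ B, (diagonal F + g • vecMulVec v v, B) ∈ blockCone ι ∧
      ∀ i j, i ≠ j → B i j = |g| * (v i * v j) := by
  have hκ' : ∀ i, 0 ≤ κ i := fun i => by
    by_cases h : i = m
    · rw [h, hκm]
    · exact hκ i h
  set T := ∑ i, κ i with hT
  have hT0 : 0 ≤ T := Finset.sum_nonneg fun i _ => hκ' i
  have hS : 0 < 1 + g * T := by positivity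
  set S := g * T with hSdef
  -- `w` agrees with `v` off `m`; the missing weight `g * e` at `m` is carried by pair terms
  set e := v m / (1 + S) with he
  have he0 : 0 ≤ e := div_nonneg (hv m) hS.le
  have hve : v m = e * (1 + S) := by rw [he]; field_simp
  set w : ι → ℝ := fun i => if i = m then S * e else v i with hw
  have hw0 : ∀ i, 0 ≤ w i := fun i => by
    simp only [hw]
    split_ifs
    · positivity
    · exact hv i
  let F' : ι → ℝ := fun i => if i = m then 0 else F i
  have hF' : ∀ i, 0 ≤ F' i := fun i => by
    simp only [F']
    split_ifs with h
    · rfl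
    · exact hF i h
  -- Since `√(F i) * √(κ i) = v i` off `m`, the sum of the `z k (z k)ᵀ` puts exactly `g * e * v i`
  -- at `(i, m)`, while `g w wᵀ` supplies `g * S * e * v i`; together they make `g * v i * v m`.
  let z : ι → ι → ℝ := fun k i =>
    (if i = k then √(F' k) else 0) + (if i = m then g * e * √(κ k) else 0)
  have hz : ∀ k i, 0 ≤ z k i := fun k i => by
    simp only [z]
    have := hF' k
    positivity
  have hFk : ∀ i, i ≠ m → √(F' i) * √(κ i) = v i := fun i h => by
    simp only [F', if_neg h]
    rw [← Real.sqrt_mul (hF i h), hFκ i h, Real.sqrt_sq (hv i)]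
  let P : Matrix ι ι ℝ := fun i j => ∑ k, z k i * z k j
  have hPm : (P, P) ∈ blockCone ι := sum_mem_blockCone z (fun _ _ => rfl) fun i j =>
    Finset.sum_congr rfl fun k _ => by rw [abs_of_nonneg (hz _ _), abs_of_nonneg (hz _ _)]
  have hP : ∀ i j, P i j = (if i = j then F' i else 0) +
      (if j = m then g * e * (√(F' i) * √(κ i)) else 0) +
      (if i = m then g * e * (√(F' j) * √(κ j)) else 0) +
      (if i = m ∧ j = m then (g * e) ^ 2 * T else 0) := by
    intro i j
    have hsq : ∀ k, z k i * z k j = (if i = k then (if i = j then F' i else 0) else 0) +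
        (if i = k then (if j = m then g * e * (√(F' i) * √(κ i)) else 0) else 0) +
        (if j = k then (if i = m then g * e * (√(F' j) * √(κ j)) else 0) else 0) +
        (if i = m ∧ j = m then (g * e) ^ 2 * κ k else 0) := by
      intro k
      have h1 := Real.mul_self_sqrt (hF' k)
      have h2 := Real.mul_self_sqrt (hκ' k)
      by_cases hik : i = k
      · by_cases hjk : j = k
        · subst hik; subst hjk
          by_cases hjm : j = m <;> simp [z, hjm] <;> subst_vars <;> grind
        · subst hik
          have : i ≠ j := fun h => hjk h.symm
          by_cases him : i = m <;> by_cases hjm : j = m <;> simp [z, him, hjm, this, hjk] <;> grind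
      · by_cases hjk : j = k
        · subst hjk
          by_cases him : i = m <;> by_cases hjm : j = m <;> simp [z, him, hjm, hik] <;> grind
        · by_cases him : i = m <;> by_cases hjm : j = m <;> simp [z, him, hjm, hik, hjk] <;> grind
    simp only [P, hsq, Finset.sum_add_distrib, Finset.sum_ite_eq, Finset.mem_univ, if_true]
    congr 1
    split_ifs
    · rw [← Finset.mul_sum]
    · simp
  let R : ι → ℝ := fun i => if i = m then F m + g * v m ^ 2 / (1 + S) else 0
  have hR : ∀ i, 0 ≤ R i := fun i => by
    simp only [R]
    split_ifs
    · have : F m + g * v m ^ 2 / (1 + S) = (F m * (1 + S) + g * v m ^ 2) / (1 + S) := by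
        field_simp
      rw [this]
      exact div_nonneg hm hS.le
    · rfl
  have hdiv : g * v m ^ 2 / (1 + S) = g * e ^ 2 * (1 + S) := by
    rw [hve]; field_simp
  have hmem := add_mem (add_mem hPm (vecMulVec_mem_blockCone hg hw0)) (diagonal_mem_blockCone hR)
  have hF'm : F' m = 0 := if_pos rfl
  have hoff : ∀ i j, i ≠ j → P i j + g * (w i * w j) = g * (v i * v j) := by
    intro i j hij
    rw [hP, if_neg hij]
    by_cases him : i = m
    · have hjm : j ≠ m := fun h => hij (him.trans h.symm)
      simp only [w, if_neg hjm, him, hFk j hjm, hve]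
      simp [hjm]
      ring
    · by_cases hjm : j = m
      · simp only [w, if_neg him, hjm, hFk i him, hve]
        simp [him]
        ring
      · simp [w, him, hjm]
  refine ⟨P + g • vecMulVec w w + diagonal R, ?_, ?_⟩
  · convert hmem using 1
    refine Prod.ext ?_ rfl
    ext i j
    simp only [Prod.mk_add_mk, Matrix.add_apply, Matrix.smul_apply, vecMulVec_apply, smul_eq_mul]
    by_cases hij : i = j
    · subst hij
      rw [hP]
      by_cases him : i = m
      · subst him
        have hv2 : v i * v i = e ^ 2 * (1 + S) ^ 2 := by rw [hve]; ring
        simp only [diagonal_apply_eq, hF'm, R, if_true, hdiv, w, Real.sqrt_zero, hv2]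
        simp only [zero_mul, mul_zero, and_self, if_true]
        rw [hSdef]
        ring
      · simp [him, R, w, F']
    · rw [diagonal_apply_ne _ hij, diagonal_apply_ne _ hij, hoff i j hij]
      ring
  · intro i j hij
    simp only [Matrix.add_apply, Matrix.smul_apply, vecMulVec_apply, smul_eq_mul]
    rw [diagonal_apply_ne _ hij, add_zero, hoff i j hij, abs_of_nonneg hg]

/-- A nonpositive rank-one matrix perturbed by a nonnegative diagonal. -/
theorem blockCone_of_nonpos {g : ℝ} (hg : g ≤ 0) {F v κ : ι → ℝ} (hv : ∀ i, 0 ≤ v i)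
    (hF : ∀ i, 0 ≤ F i) (hκ : ∀ i, 0 ≤ κ i) (hFκ : ∀ i, F i * κ i = v i ^ 2)
    (hsum : -g * ∑ i, κ i ≤ 1) :
    ∃ B, (diagonal F + g • vecMulVec v v, B) ∈ blockCone ι ∧
      ∀ i j, i ≠ j → B i j = |g| * (v i * v j) := by
  -- The vectors `α i j e_i - α j i e_j` have entries of opposite sign, as `g ≤ 0` requires. The
  -- `1/2` compensates for summing over ordered pairs, and `F i * κ i = v i ^ 2` makes `α i j * α j
  -- i` symmetric.
  let α : ι → ι → ℝ := fun i j => √(-g * (F i * κ j) / 2)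
  have hg' : 0 ≤ -g := by linarith
  have hα0 : ∀ i j, 0 ≤ α i j := fun i j => Real.sqrt_nonneg _
  have hα : ∀ i j, α i j * α i j = -g * (F i * κ j) / 2 := fun i j => by
    have := hF i
    have := hκ j
    exact Real.mul_self_sqrt (by positivity)
  have hαα : ∀ i j, α i j * α j i = -g * (v i * v j) / 2 := fun i j => by
    have := hF i
    have := hκ j
    simp only [α]
    rw [← Real.sqrt_mul (by positivity)]
    have : -g * (F i * κ j) / 2 * (-g * (F j * κ i) / 2) = (-g * (v i * v j) / 2) ^ 2 := by
      linear_combination (g ^ 2 / 4) * (F j * κ j * hFκ i + v i ^ 2 * hFκ j)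
    rw [this, Real.sqrt_sq]
    have := hv i
    have := hv j
    positivity
  let z : ι × ι → ι → ℝ := fun p k =>
    (if k = p.1 then α p.1 p.2 else 0) - (if k = p.2 then α p.2 p.1 else 0)
  let P : Matrix ι ι ℝ := fun k l => ∑ p, z p k * z p l
  let Q : Matrix ι ι ℝ := fun k l => ∑ p, |z p k| * |z p l|
  have hPQ : (P, Q) ∈ blockCone ι := sum_mem_blockCone z (fun _ _ => rfl) fun _ _ => rfl
  have hP : ∀ k l, P k l = (if k = l then -g * F k * ∑ j, κ j else 0) + g * (v k * v l) := by
    intro k l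
    have hterm : ∀ i j, z (i, j) k * z (i, j) l =
        (if k = i then (if k = l then α k j * α k j else 0) else 0) +
        (if k = j then (if k = l then α k i * α k i else 0) else 0) -
        (if k = i then (if l = j then α k l * α l k else 0) else 0) -
        (if k = j then (if l = i then α k l * α l k else 0) else 0) := by
      intro i j
      simp only [z]
      by_cases h1 : k = i <;> by_cases h2 : k = j <;> by_cases h3 : l = i <;>
        by_cases h4 : l = j <;> grind
    simp only [P, Fintype.sum_prod_type, hterm, Finset.sum_add_distrib, Finset.sum_sub_distrib]
    by_cases hkl : k = l
    · subst hkl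
      simp only [if_true]
      simp [Finset.sum_ite_irrel, hα, ← Finset.sum_div, ← Finset.mul_sum]
      linear_combination g * hFκ k
    · simp [hkl, hαα]
      ring
  have hQ : ∀ k l, k ≠ l → Q k l = |g| * (v k * v l) := by
    intro k l hkl
    have hterm : ∀ i j, |z (i, j) k| * |z (i, j) l| =
        (if k = i then (if l = j then α k l * α l k else 0) else 0) +
        (if k = j then (if l = i then α k l * α l k else 0) else 0) := by
      intro i j
      simp only [z]
      have h1 := abs_of_nonneg (hα0 k l)
      have h2 := abs_of_nonneg (hα0 l k)
      by_cases h1 : k = i <;> by_cases h2 : k = j <;> by_cases h3 : l = i <;>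
        by_cases h4 : l = j <;> grind [abs_neg, abs_zero]
    simp only [Q, Fintype.sum_prod_type, hterm, Finset.sum_add_distrib]
    simp [hαα, abs_of_nonpos hg]
  have hR : ∀ k, 0 ≤ F k * (1 - -g * ∑ j, κ j) := fun k => mul_nonneg (hF k) (by linarith)
  refine ⟨Q + diagonal fun k => F k * (1 - -g * ∑ j, κ j), ?_, ?_⟩
  · convert add_mem hPQ (diagonal_mem_blockCone hR) using 1
    refine Prod.ext ?_ rfl
    ext k l
    simp only [Prod.mk_add_mk, Matrix.add_apply, Matrix.smul_apply, vecMulVec_apply, smul_eq_mul,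
      hP]
    by_cases hkl : k = l
    · subst hkl
      simp
      ring
    · simp [hkl]
  · intro k l hkl
    simp [hQ k l hkl, diagonal_apply_ne _ hkl]

/-- The bounds on `g` are nonnegativity tests of `N` at a coordinate vector `v` and at the uniform
`v`. If `g ≥ 0`, at most one diagonal coefficient is negative, because `s + 2c ≥ 0` and two squares
`v i ^ 2` sum to at most 1. If `g < 0`, the coefficients are nonnegative and it remains to bound `-g
∑ v i ^ 2 / (s v i ^ 2 + c)` by 1. -/
theorem mem_blockCone_of_affine {s c g : ℝ} {v : ι → ℝ} (hv : ∀ i, 0 ≤ v i)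
    (hsum : ∑ i, v i ^ 2 = 1) (hc : 0 ≤ c) (hscg : 0 ≤ s + c + g) (hsc : 0 ≤ s + 2 * c)
    (hg : -g ≤ c + s / Fintype.card ι) :
    ∃ B, (diagonal (fun i => s * v i ^ 2 + c) + g • vecMulVec v v, B) ∈ blockCone ι ∧
      ∀ i j, i ≠ j → B i j = |g| * (v i * v j) := by
  have hle : ∀ i, v i ^ 2 ≤ 1 := fun i => by
    rw [← hsum]
    exact Finset.single_le_sum (f := fun i => v i ^ 2) (fun _ _ => sq_nonneg _)
      (Finset.mem_univ i)
  have hle2 : ∀ i j, i ≠ j → v i ^ 2 + v j ^ 2 ≤ 1 := fun i j hij => by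
    rw [← hsum, ← Finset.sum_pair hij (f := fun i => v i ^ 2)]
    exact Finset.sum_le_sum_of_subset_of_nonneg (Finset.subset_univ _) fun _ _ _ => sq_nonneg _
  rcases le_or_gt 0 g with hg0 | hg0
  · by_cases hF : ∀ i, 0 ≤ s * v i ^ 2 + c
    · exact blockCone_of_diagonal_nonneg hg0 hv hF
    push Not at hF
    obtain ⟨m, hm⟩ := hF
    have hs : s < 0 := by
      by_contra! hs
      nlinarith [mul_nonneg hs (sq_nonneg (v m))]
    -- every other diagonal entry is bounded below by its value at `1 - v m ^ 2`
    set y := 1 - v m ^ 2 with hy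
    set Fy := s * y + c with hFy
    have hFy0 : 0 < Fy := by
      have : s * v m ^ 2 + c + Fy = s + 2 * c := by rw [hFy, hy]; ring
      linarith
    have hFge : ∀ i, i ≠ m → Fy ≤ s * v i ^ 2 + c := fun i hi => by
      have := hle2 i m hi
      have h2 : s * y ≤ s * v i ^ 2 := mul_le_mul_of_nonpos_left (by linarith) hs.le
      linarith
    have hy0 : 0 ≤ y := by have := hle m; linarith
    let κ : ι → ℝ := fun i => if i = m then 0 else v i ^ 2 / (s * v i ^ 2 + c)
    have hκsum : ∑ i, κ i ≤ y / Fy := by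
      have hb : ∀ i, κ i ≤ (v i ^ 2 - if i = m then v m ^ 2 else 0) / Fy := fun i => by
        simp only [κ]
        split_ifs with h
        · simp [h]
        · rw [sub_zero]
          exact div_le_div_of_nonneg_left (sq_nonneg _) hFy0 (hFge i h)
      refine (Finset.sum_le_sum fun i _ => hb i).trans (le_of_eq ?_)
      rw [← Finset.sum_div, Finset.sum_sub_distrib, hsum]
      simp [hy]
    refine blockCone_of_diagonal_neg hg0 (κ := κ) m hv
      (fun i hi => (hFy0.trans_le (hFge i hi)).le)
      (fun i hi => ?_) (by simp [κ]) (fun i hi => ?_) ?_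
    · simp only [κ, if_neg hi]
      exact div_nonneg (sq_nonneg _) (hFy0.trans_le (hFge i hi)).le
    · simp only [κ, if_neg hi]
      have := (hFy0.trans_le (hFge i hi)).ne'
      field_simp
    -- With `u = v m ^ 2`, this is a quadratic in `u` symmetric under `u ↔ 1 - u`, hence the
    -- combination, with weights `1 - 4u(1-u)` and `4u(1-u)`, of its values at `u = 1` and `u =
    -- 1/2`. Both values are nonnegative.
    · have key : 0 ≤ (s * v m ^ 2 + c) * (Fy + g * y) + g * v m ^ 2 * Fy := by
        have hu : 0 ≤ 1 - 4 * (v m ^ 2 * y) := by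
          rw [hy]; nlinarith [sq_nonneg (2 * v m ^ 2 - 1)]
        have hu' : 0 ≤ 4 * (v m ^ 2 * y) := by positivity
        have h1 : 0 ≤ (1 - 4 * (v m ^ 2 * y)) * (c * (s + c + g)) := by positivity
        have h2 : 0 ≤ 4 * (v m ^ 2 * y) * ((s / 2 + c) * (s / 2 + c + g)) := by
          have : 0 ≤ s / 2 + c := by linarith
          positivity
        have e : (s * v m ^ 2 + c) * (Fy + g * y) + g * v m ^ 2 * Fy =
            (1 - 4 * (v m ^ 2 * y)) * (c * (s + c + g)) +
            4 * (v m ^ 2 * y) * ((s / 2 + c) * (s / 2 + c + g)) := by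
          rw [hFy, hy]; ring
        rw [e]; linarith
      have h3 : (s * v m ^ 2 + c) * (1 + g * (y / Fy)) + g * v m ^ 2 =
          ((s * v m ^ 2 + c) * (Fy + g * y) + g * v m ^ 2 * Fy) / Fy := by
        field_simp
      have h4 : (s * v m ^ 2 + c) * (1 + g * (y / Fy)) ≤
          (s * v m ^ 2 + c) * (1 + g * ∑ i, κ i) := by
        refine mul_le_mul_of_nonpos_left ?_ hm.le
        have := mul_le_mul_of_nonneg_left hκsum hg0
        linarith
      have h5 := div_nonneg key hFy0.le
      linarith
  · have hF : ∀ i, 0 ≤ s * v i ^ 2 + c := fun i => by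
      nlinarith [hle i, sq_nonneg (v i)]
    -- Ensures that `κ i = v i ^ 2 / F i` satisfies `F i * κ i = v i ^ 2` even when `F i = 0` and
    -- the quotient is zero by convention.
    have hF0 : ∀ i, s * v i ^ 2 + c = 0 → v i ^ 2 = 0 := by
      intro i hi
      by_contra hne
      have hpos : 0 < v i ^ 2 := lt_of_le_of_ne (sq_nonneg _) (Ne.symm hne)
      rcases le_or_gt 0 s with hs | hs
      · have h1 : 0 ≤ s * v i ^ 2 := by positivity
        have hc' : c = 0 := by linarith
        have hs' : s = 0 := by
          have : s * v i ^ 2 = 0 := by linarith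
          rcases mul_eq_zero.1 this with h | h
          · exact h
          · exact absurd h hne
        rw [hc', hs'] at hg
        simp at hg
        linarith
      · nlinarith [hle i]
    refine blockCone_of_nonpos hg0.le (κ := fun i => v i ^ 2 / (s * v i ^ 2 + c)) hv hF
      (fun i => div_nonneg (sq_nonneg _) (hF i)) (fun i => ?_) ?_
    · by_cases h : s * v i ^ 2 + c = 0
      · simp [hF0 i h]
      · field_simp
    · rw [Finset.mul_sum]
      rcases le_or_gt 0 s with hs | hs
      · -- tangent line of the concave function `x / (s x + c)` at `1 / card ι`
        have hn : (0 : ℝ) < Fintype.card ι := by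
          have : Nonempty ι := by
            by_contra h
            rw [not_nonempty_iff] at h
            simp at hsum
          exact_mod_cast Fintype.card_pos
        set n : ℝ := (Fintype.card ι : ℝ) with hn_def
        set G := c + s / n with hG
        have hGpos : 0 < G := by linarith
        have hb : ∀ i, -g * (v i ^ 2 / (s * v i ^ 2 + c)) ≤
            1 / n + c * (v i ^ 2 - 1 / n) / G := by
          intro i
          have h0 : v i ^ 2 / (s * v i ^ 2 + c) * G ≤ 1 / n + c * (v i ^ 2 - 1 / n) / G := by
            by_cases h : s * v i ^ 2 + c = 0
            · have hv0 := hF0 i h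
              have hc0 : c = 0 := by rw [hv0] at h; linarith
              rw [h, hc0]
              simp
              positivity
            · have hpos : 0 < s * v i ^ 2 + c := lt_of_le_of_ne (hF i) (Ne.symm h)
              -- The gap between the tangent line and the function is an explicit multiple of a
              -- square.
              have e : 1 / n + c * (v i ^ 2 - 1 / n) / G - v i ^ 2 / (s * v i ^ 2 + c) * G =
                  c * s * (v i ^ 2 - 1 / n) ^ 2 / (G * (s * v i ^ 2 + c)) := by
                have hG' : G = c + s * (1 / n) := by rw [hG, mul_one_div]
                have hd := hpos.ne'
                have hd' := hGpos.ne'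
                rw [hG'] at hd' ⊢
                generalize v i ^ 2 = x at hd ⊢
                generalize 1 / n = t at hd' ⊢
                rw [div_mul_eq_mul_div, eq_div_iff (mul_ne_zero hd' hd)]
                rw [sub_mul, add_mul, div_mul_eq_mul_div, div_mul_eq_mul_div,
                  mul_comm (c + s * t) (s * x + c), ← mul_assoc (x * (c + s * t)),
                  mul_right_comm (x * (c + s * t)), mul_div_cancel_right₀ _ hd,
                  ← mul_assoc (c * (x - t)), mul_div_cancel_right₀ _ hd']
                ring
              have : 0 ≤ c * s * (v i ^ 2 - 1 / n) ^ 2 / (G * (s * v i ^ 2 + c)) := by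
                positivity
              linarith
          refine le_trans ?_ h0
          rw [mul_comm]
          exact mul_le_mul_of_nonneg_left hg (div_nonneg (sq_nonneg _) (hF i))
        refine (Finset.sum_le_sum fun i _ => hb i).trans (le_of_eq ?_)
        have : ∑ _i : ι, 1 / n = 1 := by
          rw [Finset.sum_const, Finset.card_univ, nsmul_eq_mul]
          exact mul_one_div_cancel hn.ne'
        rw [Finset.sum_add_distrib, this, ← Finset.sum_div, ← Finset.mul_sum,
          Finset.sum_sub_distrib, hsum, this]
        simp
      -- For `s < 0` every denominator is at least `s + c ≥ -g`, so each term is at most `v i ^ 2`.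
      · have hb : ∀ i, -g * (v i ^ 2 / (s * v i ^ 2 + c)) ≤ v i ^ 2 := by
          intro i
          have hpos : -g ≤ s * v i ^ 2 + c := by nlinarith [hle i]
          rw [← mul_div_assoc, div_le_iff₀ (by linarith), mul_comm]
          exact mul_le_mul_of_nonneg_left hpos (sq_nonneg _)
        exact (Finset.sum_le_sum fun i _ => hb i).trans hsum.le

end BlockCone

/-! ### Positivity and separability of matrices in Schmidt form -/

section SchmidtForm

/-- The matrix with block `N` on the span of the `|ii⟩` and diagonal entries `D i k` on `|ik⟩`,
`i ≠ k`. -/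
noncomputable def schmidtForm {n : Type} [DecidableEq n] (N : Matrix n n ℝ) (D : n → n → ℝ) :
    Op (n × n) :=
  Matrix.of fun x y => (if x.1 = x.2 ∧ y.1 = y.2 then (N x.1 y.1 : ℂ) else 0) +
    if x = y ∧ x.1 ≠ x.2 then (D x.1 x.2 : ℂ) else 0

variable {n : Type} [DecidableEq n]

theorem schmidtForm_add (N N' : Matrix n n ℝ) (D D' : n → n → ℝ) :
    schmidtForm (N + N') (D + D') = schmidtForm N D + schmidtForm N' D' := by
  ext x y
  simp only [schmidtForm, Matrix.of_apply, Matrix.add_apply, Pi.add_apply]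
  split_ifs <;> push_cast <;> ring

theorem schmidtForm_zero_left (D : n → n → ℝ) :
    schmidtForm 0 D = diagonal fun x => if x.1 ≠ x.2 then (D x.1 x.2 : ℂ) else 0 := by
  ext x y
  by_cases h : x = y <;> simp [schmidtForm, h]

variable [Fintype n]

/-- Orthogonality of characters. Cube roots of unity are used because signs would also keep the
pairing `i = l`, `j = k`, where the exponent is `2 (s i - s j)`. -/
theorem sum_stdAddChar_eq (i j k l : n) :
    ∑ s : n → ZMod 3, ZMod.stdAddChar (s i - s j - s k + s l) =
      if (i = k ∧ j = l) ∨ (i = j ∧ k = l) then (3 : ℂ) ^ Fintype.card n else 0 := by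
  split_ifs with h
  · have : ∀ s : n → ZMod 3, s i - s j - s k + s l = 0 := by
      intro s
      rcases h with ⟨rfl, rfl⟩ | ⟨rfl, rfl⟩ <;> ring
    simp [this, ZMod.card]
  · let χ : AddChar (n → ZMod 3) ℂ := (ZMod.stdAddChar (N := 3)).compAddMonoidHom
      (Pi.evalAddMonoidHom (fun _ : n => ZMod 3) i - Pi.evalAddMonoidHom _ j - Pi.evalAddMonoidHom _ k +
        Pi.evalAddMonoidHom _ l)
    have hχ : ∀ s, χ s = ZMod.stdAddChar (s i - s j - s k + s l) := fun s => rfl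
    have hne : χ ≠ 0 := by
      have key : ∃ t : n → ZMod 3, t i - t j - t k + t l ≠ 0 := by
        by_contra! hall
        have h1 := hall (Pi.single i 1)
        have h2 := hall (Pi.single l 1)
        have h10 : (1 : ZMod 3) ≠ 0 := by decide
        have h20 : (1 : ZMod 3) + 1 ≠ 0 := by decide
        simp only [Pi.single_apply] at h1 h2
        by_cases e1 : i = j <;> by_cases e2 : i = k <;> by_cases e3 : i = l <;>
          by_cases e4 : j = l <;> by_cases e5 : k = l <;> grind
      obtain ⟨t, ht⟩ := key
      intro h0
      apply ht
      apply ZMod.injective_stdAddChar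
      rw [← hχ, h0]
      simp
    have := AddChar.sum_eq_zero_iff_ne_zero.2 hne
    simpa [hχ] using this

/-- Average product vectors carrying phase `s i` on the first factor and `-s k` on the second: only
the block on the `|ii⟩` and the diagonal survive. The weights `r` cancel in the block and tilt the
diagonal; the signs of `z` sit on the second factor. -/
theorem isSeparable_schmidtForm_vecMulVec (z r : n → ℝ) (hr : ∀ i, 0 < r i) :
    IsSeparable (schmidtForm (vecMulVec z z) fun i k => |z i| * |z k| * (r i / r k)) := by
  let x : (n → ZMod 3) → n → ℂ := fun s i => (√(|z i| * r i) : ℂ) * ZMod.stdAddChar (s i)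
  let y : (n → ZMod 3) → n → ℂ := fun s k =>
    ((SignType.sign (z k) : ℝ) * √(|z k| / r k) : ℂ) * ZMod.stdAddChar (-s k)
  have hsep := (IsSeparable.of_fintype (fun s => vecMulVec (x s) (star (x s)))
    (fun s => vecMulVec (y s) (star (y s))) (fun s => posSemidef_vecMulVec_self_star _)
    (fun s => posSemidef_vecMulVec_self_star _)).smul
    (t := ((3 : ℝ) ^ Fintype.card n)⁻¹) (by positivity)
  convert hsep using 1
  ext ⟨i, k⟩ ⟨j, l⟩
  have hconj : ∀ a : ZMod 3, (starRingEnd ℂ) (ZMod.stdAddChar a) = ZMod.stdAddChar (-a) :=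
    fun a => (AddChar.map_neg_eq_conj _ _).symm
  have hterm : ∀ s, (vecMulVec (x s) (star (x s)) ⊗ₖ vecMulVec (y s) (star (y s))) (i, k) (j, l) =
      ((√(|z i| * r i) * √(|z j| * r j) * ((SignType.sign (z k) : ℝ) * √(|z k| / r k)) *
        ((SignType.sign (z l) : ℝ) * √(|z l| / r l)) : ℝ) : ℂ) *
        ZMod.stdAddChar (s i - s j - s k + s l) := by
    intro s
    have e : (ZMod.stdAddChar (s i - s j - s k + s l) : ℂ) = ZMod.stdAddChar (s i) *
        ZMod.stdAddChar (-s j) * ZMod.stdAddChar (-s k) * ZMod.stdAddChar (s l) := by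
      simp only [← AddChar.map_add_eq_mul, sub_eq_add_neg]
    simp only [kroneckerMap_apply, vecMulVec_apply, x, y, Pi.star_apply, star_mul',
      RCLike.star_def, hconj, neg_neg, e, Complex.conj_ofReal]
    push_cast
    ring
  rw [Matrix.smul_apply, Matrix.sum_apply]
  simp only [hterm, ← Finset.mul_sum, sum_stdAddChar_eq]
  have h3 : ((3 : ℂ) ^ Fintype.card n) ≠ 0 := by positivity
  have hs : ∀ i, √(|z i| * r i) * √(|z i| / r i) = |z i| := fun i => by
    have := hr i
    rw [← Real.sqrt_mul (by positivity)]
    have : |z i| * r i * (|z i| / r i) = |z i| ^ 2 := by field_simp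
    rw [this, Real.sqrt_sq (abs_nonneg _)]
  have hsgn : ∀ i, (SignType.sign (z i) : ℝ) * |z i| = z i := fun i => sign_mul_abs _
  by_cases h1 : i = k ∧ j = l
  · obtain ⟨rfl, rfl⟩ := h1
    have hval : √(|z i| * r i) * √(|z j| * r j) * ((SignType.sign (z i) : ℝ) * √(|z i| / r i)) *
        ((SignType.sign (z j) : ℝ) * √(|z j| / r j)) = z i * z j := by
      calc _ = (SignType.sign (z i) * (√(|z i| * r i) * √(|z i| / r i))) *
            (SignType.sign (z j) * (√(|z j| * r j) * √(|z j| / r j))) := by ring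
        _ = _ := by rw [hs, hs, hsgn, hsgn]
    rw [hval]
    simp [schmidtForm, vecMulVec_apply]
    field_simp
  · by_cases h2 : i = j ∧ k = l
    · obtain ⟨rfl, rfl⟩ := h2
      have hik : i ≠ k := fun h => h1 ⟨h, h⟩
      have hval : √(|z i| * r i) * √(|z i| * r i) *
          ((SignType.sign (z k) : ℝ) * √(|z k| / r k)) *
          ((SignType.sign (z k) : ℝ) * √(|z k| / r k)) = |z i| * |z k| * (r i / r k) := by
        have hi := hr i
        have hk := hr k
        have e1 := Real.mul_self_sqrt (show 0 ≤ |z i| * r i by positivity)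
        have e2 := Real.mul_self_sqrt (show 0 ≤ |z k| / r k by positivity)
        have e3 : (SignType.sign (z k) : ℝ) * SignType.sign (z k) * |z k| = |z k| := by
          rcases lt_trichotomy (z k) 0 with h | h | h <;> simp [h]
        calc _ = (√(|z i| * r i) * √(|z i| * r i)) * (SignType.sign (z k) * SignType.sign (z k) *
              (√(|z k| / r k) * √(|z k| / r k))) := by ring
          _ = |z i| * (SignType.sign (z k) * SignType.sign (z k) * |z k|) * (r i / r k) := by
              rw [e1, e2]; ring
          _ = _ := by rw [e3]
      rw [hval]
      simp [schmidtForm, hik]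
      field_simp
    · simp [schmidtForm, h1, h2]

theorem isSeparable_schmidtForm_zero_left {D : n → n → ℝ} (hD : ∀ i k, i ≠ k → 0 ≤ D i k) :
    IsSeparable (schmidtForm 0 D) := by
  have hsep := IsSeparable.of_fintype
    (fun x : n × n => diagonal (Pi.single x.1 (if x.1 ≠ x.2 then (D x.1 x.2 : ℂ) else 0)))
    (fun x : n × n => diagonal (Pi.single x.2 (1 : ℂ))) (fun x => ?_) (fun x => ?_)
  · convert hsep using 1
    rw [schmidtForm_zero_left]
    ext ⟨i, k⟩ ⟨j, l⟩
    simp only [diagonal_kronecker_diagonal, Matrix.sum_apply, diagonal_apply]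
    by_cases h : (i, k) = (j, l)
    · simp only [if_pos h]
      rw [Fintype.sum_eq_single (i, k)]
      · simp
      · rintro ⟨a, b⟩ hab
        by_cases ha : i = a
        · have hb : k ≠ b := fun hb => hab (by rw [ha, hb])
          simp [hb]
        · simp [ha]
    · have h' : ¬(i = j ∧ k = l) := fun e => h (Prod.ext e.1 e.2)
      simp [h']
  · rw [posSemidef_diagonal_iff]
    intro i
    by_cases hi : i = x.1
    · subst hi
      rw [Pi.single_eq_same]
      split_ifs with h
      · exact_mod_cast hD _ _ h
      · exact le_rfl
    · simp [hi]
  · rw [posSemidef_diagonal_iff]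
    intro i
    by_cases hi : i = x.2
    · subst hi
      simp
    · simp [hi]

theorem posSemidef_schmidtForm_vecMulVec (z : n → ℝ) :
    (schmidtForm (vecMulVec z z) 0).PosSemidef := by
  convert posSemidef_vecMulVec_self_star
    (fun x : n × n => if x.1 = x.2 then (z x.1 : ℂ) else 0) using 1
  ext x y
  by_cases hx : x.1 = x.2 <;> by_cases hy : y.1 = y.2 <;>
    simp [schmidtForm, vecMulVec_apply, hx, hy]

theorem posSemidef_schmidtForm {N B : Matrix n n ℝ} (h : (N, B) ∈ blockCone n)
    {D : n → n → ℝ} (hD : ∀ i k, i ≠ k → 0 ≤ D i k) : (schmidtForm N D).PosSemidef := by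
  have hD' : (schmidtForm 0 D).PosSemidef := by
    rw [schmidtForm_zero_left, posSemidef_diagonal_iff]
    intro x
    split_ifs with hx
    · exact_mod_cast hD _ _ hx
    · exact le_rfl
  have hN : ∀ p ∈ blockCone n, (schmidtForm p.1 0).PosSemidef := by
    intro p hp
    induction hp using AddSubmonoid.closure_induction with
    | mem x hx =>
      obtain ⟨z, rfl⟩ := hx
      exact posSemidef_schmidtForm_vecMulVec z
    | zero =>
      convert PosSemidef.zero (n := n × n) (R := ℂ) using 1
      ext x y
      simp [schmidtForm]
    | add x y _ _ hx hy =>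
      have := schmidtForm_add x.1 y.1 0 0
      rw [add_zero] at this
      rw [Prod.fst_add, this]
      exact hx.add hy
  have := schmidtForm_add N 0 0 D
  rw [add_zero, zero_add] at this
  rw [this]
  exact (hN _ h).add hD'

/-- Separability is additive along the cone for a common `r`, and the surplus of `D` is a
nonnegative diagonal, hence a sum of product terms. -/
theorem isSeparable_schmidtForm {N B : Matrix n n ℝ} (h : (N, B) ∈ blockCone n)
    {r : n → ℝ} (hr : ∀ i, 0 < r i) {D : n → n → ℝ}
    (hD : ∀ i k, i ≠ k → B i k * (r i / r k) ≤ D i k) : IsSeparable (schmidtForm N D) := by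
  have hN : ∀ p ∈ blockCone n,
      IsSeparable (schmidtForm p.1 fun i k => p.2 i k * (r i / r k)) := by
    intro p hp
    induction hp using AddSubmonoid.closure_induction with
    | mem x hx =>
      obtain ⟨z, rfl⟩ := hx
      exact isSeparable_schmidtForm_vecMulVec z r hr
    | zero =>
      convert IsSeparable.zero (m := n) (n := n) using 1
      ext x y
      simp [schmidtForm]
    | add x y _ _ hx hy =>
      have := hx.add hy
      rw [← schmidtForm_add] at this
      have e : (fun i k => (x + y).2 i k * (r i / r k)) =
          (fun i k => x.2 i k * (r i / r k)) + fun i k => y.2 i k * (r i / r k) := by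
        funext i k
        exact add_mul _ _ _
      rw [e]
      exact this
  have := (hN _ h).add (isSeparable_schmidtForm_zero_left
    (D := fun i k => D i k - B i k * (r i / r k)) fun i k hik => sub_nonneg.2 (hD i k hik))
  rw [← schmidtForm_add, add_zero] at this
  convert this using 2
  funext i k
  simp

end SchmidtForm

/-! ### Covariance, and outputs on Schmidt vectors -/

section LocalDepolarizing

variable {d : ℕ}

theorem localDepolarizing_apply (p q : ℝ) (X : Op (Fin d × Fin d)) (i j k l : Fin d) :
    localDepolarizing d p q X (i, k) (j, l) =
      (p * q : ℝ) * X (i, k) (j, l) +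
      (if k = l then ((p * ((1 - q) / d) : ℝ) : ℂ) * ∑ m, X (i, m) (j, m) else 0) +
      (if i = j then ((q * ((1 - p) / d) : ℝ) : ℂ) * ∑ m, X (m, k) (m, l) else 0) +
      (if i = j ∧ k = l then (((1 - p) / d * ((1 - q) / d) : ℝ) : ℂ) *
        ∑ m, ∑ m', X (m, m') (m, m') else 0) := by
  induction X using kronecker_induction with
  | hk A B =>
    have hA : ∀ m, ∑ x, A m m * B x x = A m m * B.trace := fun m => by
      rw [← Finset.mul_sum]; rfl
    have hB : ∑ m, A m m * B.trace = A.trace * B.trace := by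
      rw [← Finset.sum_mul]; rfl
    have h1 : ∑ m, A i j * B m m = A i j * B.trace := by rw [← Finset.mul_sum]; rfl
    have h2 : ∑ m, A m m * B k l = A.trace * B k l := by rw [← Finset.sum_mul]; rfl
    rw [localDepolarizing, tensorMap_kronecker, depolarizing_apply, depolarizing_apply]
    simp only [kroneckerMap_apply, Matrix.add_apply, Matrix.smul_apply, one_apply, smul_eq_mul,
      hA, hB, h1, h2]
    push_cast
    by_cases hij : i = j <;> by_cases hkl : k = l <;> simp only [hij, hkl] <;> simp <;> ring
  | hadd X Y hX hY =>
    rw [map_add]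
    simp only [Matrix.add_apply, hX, hY, Finset.sum_add_distrib]
    split_ifs <;> ring

theorem depolarizing_conj (q : ℝ) {U : Op (Fin d)} (hU : U ∈ unitaryGroup (Fin d) ℂ)
    (X : Op (Fin d)) : depolarizing d q (U * X * Uᴴ) = U * depolarizing d q X * Uᴴ := by
  have h1 : U * Uᴴ = 1 := mem_unitaryGroup_iff.1 hU
  have h2 : Uᴴ * U = 1 := mem_unitaryGroup_iff'.1 hU
  have ht : (U * X * Uᴴ).trace = X.trace := by
    rw [trace_mul_comm, ← Matrix.mul_assoc, h2, Matrix.one_mul]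
  simp only [depolarizing_apply, ht, Matrix.mul_add, Matrix.add_mul, Matrix.mul_smul,
    Matrix.smul_mul, Matrix.mul_one, h1]

theorem localDepolarizing_conj (p q : ℝ) {U V : Op (Fin d)} (hU : U ∈ unitaryGroup (Fin d) ℂ)
    (hV : V ∈ unitaryGroup (Fin d) ℂ) (X : Op (Fin d × Fin d)) :
    localDepolarizing d p q ((U ⊗ₖ V) * X * (U ⊗ₖ V)ᴴ) =
      (U ⊗ₖ V) * localDepolarizing d p q X * (U ⊗ₖ V)ᴴ := by
  induction X using kronecker_induction with
  | hk A B =>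
    simp only [conjTranspose_kronecker, ← mul_kronecker_mul, localDepolarizing,
      tensorMap_kronecker, depolarizing_conj p hU, depolarizing_conj q hV]
  | hadd X Y hX hY => simp only [Matrix.mul_add, Matrix.add_mul, map_add, hX, hY]

/-- The vector `∑ i, v i • |ii⟩`. -/
def schmidtVector (v : Fin d → ℝ) (x : Fin d × Fin d) : ℂ :=
  if x.1 = x.2 then (v x.1 : ℂ) else 0

/-- The output of `Δ_p ⊗ Δ_q` on the pure state `∑ i, v i • |ii⟩`. -/
noncomputable def schmidtOutput (p q : ℝ) (v : Fin d → ℝ) : Op (Fin d × Fin d) :=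
  schmidtForm
    (diagonal (fun i => (p * ((1 - q) / d) + q * ((1 - p) / d)) * v i ^ 2 +
      (1 - p) / d * ((1 - q) / d)) + (p * q) • vecMulVec v v)
    (fun i k => p * ((1 - q) / d) * v i ^ 2 + q * ((1 - p) / d) * v k ^ 2 +
      (1 - p) / d * ((1 - q) / d))

theorem localDepolarizing_schmidtVector (p q : ℝ) {v : Fin d → ℝ} (hv : ∑ i, v i ^ 2 = 1) :
    localDepolarizing d p q (vecMulVec (schmidtVector v) (star (schmidtVector v))) =
      schmidtOutput p q v := by
  have hv' : ∑ i, (v i : ℂ) * v i = 1 := by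
    have : ((∑ i, v i ^ 2 : ℝ) : ℂ) = 1 := by rw [hv]; simp
    rw [← this]
    push_cast
    simp only [sq]
  ext ⟨i, k⟩ ⟨j, l⟩
  rw [localDepolarizing_apply]
  have h1 : ∑ m, vecMulVec (schmidtVector v) (star (schmidtVector v)) (i, m) (j, m) =
      if i = j then (v i : ℂ) * v i else 0 := by
    simp only [vecMulVec_apply, schmidtVector, Pi.star_apply]
    by_cases h : i = j
    · subst h; simp
    · simp [h, Ne.symm h]
  have h2 : ∑ m, vecMulVec (schmidtVector v) (star (schmidtVector v)) (m, k) (m, l) =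
      if k = l then (v k : ℂ) * v k else 0 := by
    simp only [vecMulVec_apply, schmidtVector, Pi.star_apply]
    by_cases h : k = l
    · subst h; simp
    · simp [h]
  have h3 : ∑ m, ∑ m', vecMulVec (schmidtVector v) (star (schmidtVector v)) (m, m') (m, m') =
      1 := by
    simp [vecMulVec_apply, schmidtVector, hv']
  rw [h1, h2, h3]
  simp only [schmidtOutput, schmidtForm, vecMulVec_apply, schmidtVector, Pi.star_apply,
    Matrix.of_apply, Matrix.add_apply, Matrix.smul_apply, diagonal_apply, Prod.mk.injEq,
    smul_eq_mul]
  by_cases hik : i = k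
  · subst hik
    by_cases hjl : j = l
    · subst hjl
      by_cases hij : i = j
      · subst hij
        simp
        ring
      · simp [hij]
    · by_cases hij : i = j
      · subst hij
        simp [hjl]
      · simp [hij, hjl]
  · by_cases hij : i = j
    · subst hij
      by_cases hkl : k = l
      · subst hkl
        simp [hik]
        ring
      · simp [hik, hkl]
    · by_cases hkl : k = l
      · subst hkl
        simp [hik, hij]
      · simp [hik, hij, hkl]

theorem transpose_mem_unitaryGroup {n : Type} [Fintype n] [DecidableEq n] {V : Op n}
    (hV : V ∈ unitaryGroup n ℂ) : Vᵀ ∈ unitaryGroup n ℂ := by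
  rw [mem_unitaryGroup_iff, star_eq_conjTranspose, show Vᵀᴴ = Vᴴᵀ from rfl,
    ← transpose_mul, ← star_eq_conjTranspose, mem_unitaryGroup_iff'.1 hV, transpose_one]

/-- Up to local unitaries, the output on a pure state is determined by its Schmidt coefficients. -/
theorem exists_localDepolarizing_eq_conj (p q : ℝ) {u : Fin d × Fin d → ℂ}
    (hu : ∑ x, ‖u x‖ ^ 2 = 1) :
    ∃ (U V : Op (Fin d)) (v : Fin d → ℝ), (∀ i, 0 ≤ v i) ∧ ∑ i, v i ^ 2 = 1 ∧
      localDepolarizing d p q (vecMulVec u (star u)) =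
        (U ⊗ₖ V) * schmidtOutput p q v * (U ⊗ₖ V)ᴴ := by
  obtain ⟨U, hU, V, hV, v, hv, hA⟩ :=
    exists_singularValueDecomposition (Matrix.of fun i k => u (i, k))
  have hVt := transpose_mem_unitaryGroup hV
  -- Reshaping the coefficient matrix into a vector turns right multiplication by `V` into the
  -- action of `Vᵀ` on the second factor.
  have hvec : u = (U ⊗ₖ Vᵀ) *ᵥ schmidtVector v := by
    ext ⟨i, k⟩
    have := congrFun (congrFun hA i) k
    rw [Matrix.of_apply] at this
    rw [this]
    simp [mul_apply, mulVec, dotProduct, Fintype.sum_prod_type, schmidtVector, diagonal_apply]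
    refine Finset.sum_congr rfl fun m _ => ?_
    ring
  have hX : vecMulVec u (star u) = (U ⊗ₖ Vᵀ) *
      vecMulVec (schmidtVector v) (star (schmidtVector v)) * (U ⊗ₖ Vᵀ)ᴴ := by
    rw [hvec, mul_vecMulVec, vecMulVec_mul, star_mulVec]
  have hUV : (U ⊗ₖ Vᵀ)ᴴ * (U ⊗ₖ Vᵀ) = 1 := by
    rw [conjTranspose_kronecker, ← mul_kronecker_mul, ← star_eq_conjTranspose,
      ← star_eq_conjTranspose, mem_unitaryGroup_iff'.1 hU, mem_unitaryGroup_iff'.1 hVt,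
      one_kronecker_one]
  have hsum : ∑ i, v i ^ 2 = 1 := by
    have ht := congrArg Matrix.trace hX
    rw [trace_mul_comm, ← Matrix.mul_assoc, hUV, Matrix.one_mul, trace_vecMulVec,
      trace_vecMulVec] at ht
    have e1 : u ⬝ᵥ star u = 1 := by
      rw [dotProduct, ← Complex.ofReal_one, ← hu]
      push_cast
      exact Finset.sum_congr rfl fun x _ => Complex.mul_conj' _
    have e2 : schmidtVector v ⬝ᵥ star (schmidtVector v) = ((∑ i, v i ^ 2 : ℝ) : ℂ) := by
      simp [dotProduct, Fintype.sum_prod_type, schmidtVector, sq]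
    rw [e1, e2] at ht
    exact_mod_cast ht.symm
  refine ⟨U, Vᵀ, v, hv, hsum, ?_⟩
  rw [hX, localDepolarizing_conj p q hU hVt, localDepolarizing_schmidtVector p q hsum]

theorem posSemidef_sub_nonneg {n : Type} [Fintype n] [DecidableEq n] {M : Op n}
    (hM : M.PosSemidef) (x y : n) : 0 ≤ M x x + M y y - M x y - M y x := by
  have e : star (Pi.single x 1 - Pi.single y 1 : n → ℂ) ⬝ᵥ
      (M *ᵥ (Pi.single x 1 - Pi.single y 1)) = M x x + M y y - M x y - M y x := by
    simp [mulVec_sub, sub_dotProduct, dotProduct_sub]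
    ring
  rw [← e]
  exact hM.dotProduct_mulVec_nonneg _

/-- On a rank-one projection the output has eigenvalue `q + (1-q)/d` on its range and `(1-q)/d` on
the complement; the two bounds say that these are nonnegative. -/
theorem isPositiveMap_depolarizing_iff (hd : 2 ≤ d) (q : ℝ) :
    IsPositiveMap (depolarizing d q) ↔ -(1 / ((d : ℝ) - 1)) ≤ q ∧ q ≤ 1 := by
  have hd' : (2 : ℝ) ≤ d := by exact_mod_cast hd
  have hlow : -(1 / ((d : ℝ) - 1)) ≤ q ↔ 0 ≤ q + (1 - q) / d := by
    have e : q + (1 - q) / d = (1 + q * (d - 1)) / d := by field_simp; ring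
    rw [e, le_div_iff₀ (by linarith), zero_mul, ← neg_div, div_le_iff₀ (by linarith)]
    constructor <;> intro h <;> linarith
  have hup : q ≤ 1 ↔ 0 ≤ (1 - q) / d := by
    rw [le_div_iff₀ (by linarith), zero_mul, sub_nonneg]
  rw [hlow, hup]
  constructor
  · intro h
    let i : Fin d := ⟨0, by omega⟩
    let j : Fin d := ⟨1, by omega⟩
    have hij : i ≠ j := by simp [i, j]
    have hX := h (diagonal (Pi.single i 1)) (by
      rw [posSemidef_diagonal_iff]
      intro k
      by_cases hk : k = i <;> simp [hk])
    rw [depolarizing_apply] at hX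
    have hi := hX.diag_nonneg (i := i)
    have hj := hX.diag_nonneg (i := j)
    simp [trace_diagonal, hij.symm] at hi hj
    exact ⟨by exact_mod_cast hi, by exact_mod_cast hj⟩
  · rintro ⟨h1, h2⟩ X hX
    refine cone_of_unit_vectors PosSemidef.zero (fun _ _ => PosSemidef.add)
      (fun t X ht hX => hX.smul (by exact_mod_cast ht)) _ (fun u hu => ?_) hX
    have hunit : u ⬝ᵥ star u = 1 := by
      rw [dotProduct, ← Complex.ofReal_one, ← hu]
      push_cast
      exact Finset.sum_congr rfl fun x _ => Complex.mul_conj' _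
    have hred : (1 - vecMulVec u (star u)).PosSemidef := by
      have hH : (1 - vecMulVec u (star u))ᴴ = 1 - vecMulVec u (star u) := by
        rw [conjTranspose_sub, conjTranspose_one, conjTranspose_vecMulVec, star_star]
      have hidem : (1 - vecMulVec u (star u)) * (1 - vecMulVec u (star u)) =
          1 - vecMulVec u (star u) := by
        have : vecMulVec u (star u) * vecMulVec u (star u) = vecMulVec u (star u) := by
          rw [vecMulVec_mul_vecMulVec, dotProduct_comm, hunit, one_smul]
        rw [Matrix.mul_sub, Matrix.sub_mul, Matrix.sub_mul, this]
        simp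
      have := posSemidef_conjTranspose_mul_self (1 - vecMulVec u (star u))
      rwa [hH, hidem] at this
    rw [depolarizing_apply, trace_vecMulVec, hunit, one_smul]
    have e : (q : ℂ) • vecMulVec u (star u) + ((1 - (q : ℂ)) / d) • (1 : Op (Fin d)) =
        ((q + (1 - q) / d : ℝ) : ℂ) • vecMulVec u (star u) +
        (((1 - q) / d : ℝ) : ℂ) • (1 - vecMulVec u (star u)) := by
      rw [smul_sub]
      push_cast
      module
    rw [e]
    exact ((posSemidef_vecMulVec_self_star u).smul (by exact_mod_cast h1)).add
      (hred.smul (by exact_mod_cast h2))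

end LocalDepolarizing

/-! ### The positivity, annihilation and PPT criteria -/

section Characterization

variable {d : ℕ}

theorem depolarizing_bounds_iff (hd : 2 ≤ d) (q : ℝ) :
    (-(1 / ((d : ℝ) - 1)) ≤ q ∧ q ≤ 1) ↔ 0 ≤ q + (1 - q) / d ∧ 0 ≤ (1 - q) / d := by
  have hd' : (2 : ℝ) ≤ d := by exact_mod_cast hd
  have e : q + (1 - q) / d = (1 + q * (d - 1)) / d := by field_simp; ring
  rw [e, le_div_iff₀ (by linarith), zero_mul, ← neg_div, div_le_iff₀ (by linarith),
    le_div_iff₀ (by linarith), zero_mul, sub_nonneg]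
  constructor <;> rintro ⟨h, h'⟩ <;> constructor <;> linarith

theorem max_entangled_condition_iff (hd : 2 ≤ d) (p q : ℝ) :
    -(p * q) ≤ (1 - p) / d * ((1 - q) / d) +
      (p * ((1 - q) / d) + q * ((1 - p) / d)) / d ↔ -1 ≤ ((d : ℝ) ^ 2 - 1) * p * q := by
  have hd' : (2 : ℝ) ≤ d := by exact_mod_cast hd
  have e : (1 - p) / d * ((1 - q) / d) + (p * ((1 - q) / d) + q * ((1 - p) / d)) / d =
      (1 - p * q) / (d : ℝ) ^ 2 := by
    field_simp; ring
  rw [e, le_div_iff₀ (by positivity)]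
  constructor <;> intro h <;> linarith

theorem annihilation_condition_iff (hd : 2 ≤ d) (p q : ℝ) :
    p * q ≤ p * ((1 - q) / d) + q * ((1 - p) / d) + 2 * ((1 - p) / d * ((1 - q) / d)) ↔
      ((d : ℝ) ^ 2 + 2 * d - 2) * p * q ≤ 2 + ((d : ℝ) - 2) * (p + q) := by
  have hd' : (2 : ℝ) ≤ d := by exact_mod_cast hd
  have e : p * ((1 - q) / d) + q * ((1 - p) / d) + 2 * ((1 - p) / d * ((1 - q) / d)) =
      (d * (p + q) - 2 * d * (p * q) + 2 - 2 * (p + q) + 2 * (p * q)) / (d : ℝ) ^ 2 := by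
    field_simp; ring
  rw [e, le_div_iff₀ (by positivity)]
  constructor <;> intro h <;> linarith

theorem mem_blockCone_schmidtOutput (hd : 2 ≤ d) {p q : ℝ}
    (hp : 0 ≤ p + (1 - p) / d ∧ 0 ≤ (1 - p) / d) (hq : 0 ≤ q + (1 - q) / d ∧ 0 ≤ (1 - q) / d)
    (hpq : -1 ≤ ((d : ℝ) ^ 2 - 1) * p * q) {v : Fin d → ℝ} (hv : ∀ i, 0 ≤ v i)
    (hsum : ∑ i, v i ^ 2 = 1) :
    ∃ B, (diagonal (fun i => (p * ((1 - q) / d) + q * ((1 - p) / d)) * v i ^ 2 +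
      (1 - p) / d * ((1 - q) / d)) + (p * q) • vecMulVec v v, B) ∈ blockCone (Fin d) ∧
      ∀ i j, i ≠ j → B i j = |p * q| * (v i * v j) := by
  -- Here `s + c + g = (p + P)(q + Q)` and `s + 2c = (p + P)Q + P(q + Q)`, with `P = (1-p)/d` and `Q
  -- = (1-q)/d`: products of eigenvalues of the local outputs.
  refine mem_blockCone_of_affine hv hsum (mul_nonneg hp.2 hq.2) ?_ ?_ ?_
  · have := mul_nonneg hp.1 hq.1
    linarith
  · have h1 := mul_nonneg hp.1 hq.2
    have h2 := mul_nonneg hp.2 hq.1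
    linarith
  · rw [Fintype.card_fin]
    exact (max_entangled_condition_iff hd p q).2 hpq

/-- Since `v i ^ 2 + v k ^ 2 ≤ 1`, the constant term dominates its multiple by this sum, which makes
the lower bound homogeneous in `v` and comparable with `v i * v k`. -/
theorem schmidt_diagonal_bound {p q : ℝ}
    (hp : 0 ≤ p + (1 - p) / d ∧ 0 ≤ (1 - p) / d) (hq : 0 ≤ q + (1 - q) / d ∧ 0 ≤ (1 - q) / d)
    {v : Fin d → ℝ} (hsum : ∑ i, v i ^ 2 = 1) (i k : Fin d) (hik : i ≠ k) :
    (p + (1 - p) / d) * ((1 - q) / d) * v i ^ 2 + (q + (1 - q) / d) * ((1 - p) / d) * v k ^ 2 ≤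
      p * ((1 - q) / d) * v i ^ 2 + q * ((1 - p) / d) * v k ^ 2 +
      (1 - p) / d * ((1 - q) / d) := by
  have hle : v i ^ 2 + v k ^ 2 ≤ 1 := by
    rw [← hsum, ← Finset.sum_pair hik (f := fun i => v i ^ 2)]
    exact Finset.sum_le_sum_of_subset_of_nonneg (Finset.subset_univ _) fun _ _ _ => sq_nonneg _
  have := mul_le_mul_of_nonneg_left hle (mul_nonneg hp.2 hq.2)
  linarith

theorem posSemidef_schmidtOutput (hd : 2 ≤ d) {p q : ℝ}
    (hp : 0 ≤ p + (1 - p) / d ∧ 0 ≤ (1 - p) / d) (hq : 0 ≤ q + (1 - q) / d ∧ 0 ≤ (1 - q) / d)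
    (hpq : -1 ≤ ((d : ℝ) ^ 2 - 1) * p * q) {v : Fin d → ℝ} (hv : ∀ i, 0 ≤ v i)
    (hsum : ∑ i, v i ^ 2 = 1) : (schmidtOutput p q v).PosSemidef := by
  obtain ⟨B, hB, -⟩ := mem_blockCone_schmidtOutput hd hp hq hpq hv hsum
  refine posSemidef_schmidtForm hB fun i k hik => ?_
  refine le_trans ?_ (schmidt_diagonal_bound hp hq hsum i k hik)
  obtain ⟨h1, h2⟩ := hp
  obtain ⟨h3, h4⟩ := hq
  positivity

theorem isSeparable_schmidtOutput (hd : 2 ≤ d) {p q : ℝ}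
    (hp : 0 ≤ p + (1 - p) / d ∧ 0 ≤ (1 - p) / d) (hq : 0 ≤ q + (1 - q) / d ∧ 0 ≤ (1 - q) / d)
    (hpq : -1 ≤ ((d : ℝ) ^ 2 - 1) * p * q)
    (hEA : ((d : ℝ) ^ 2 + 2 * d - 2) * p * q ≤ 2 + ((d : ℝ) - 2) * (p + q))
    {v : Fin d → ℝ} (hv : ∀ i, 0 ≤ v i) (hsum : ∑ i, v i ^ 2 = 1) :
    IsSeparable (schmidtOutput p q v) := by
  obtain ⟨B, hB, hoff⟩ := mem_blockCone_schmidtOutput hd hp hq hpq hv hsum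
  rw [← annihilation_condition_iff hd] at hEA
  set α := (p + (1 - p) / d) * ((1 - q) / d) with hα
  set β := (q + (1 - q) / d) * ((1 - p) / d) with hβ
  have hα0 : 0 ≤ α := mul_nonneg hp.1 hq.2
  have hβ0 : 0 ≤ β := mul_nonneg hq.1 hp.2
  have hg : |p * q| ≤ α + β := by
    have h1 := mul_nonneg hp.1 hq.1
    have h2 := mul_nonneg hp.2 hq.2
    rw [abs_le]
    constructor <;> rw [hα, hβ] <;> linarith
  -- The AM-GM weight matching `α v i ^ 2 + β v k ^ 2`. If `α + β = 0`, both vanish and the default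
  -- `θ = 0` is harmless.
  set θ := α / (α + β) with hθ
  have hθα : (α + β) * θ = α := by
    by_cases h : α + β = 0
    · rw [h]; linarith
    · rw [hθ]; field_simp
  have hθ0 : 0 ≤ θ := by positivity
  have hθ1 : 0 ≤ 1 - θ := sub_nonneg.2 (div_le_one_of_le₀ (by linarith) (by positivity))
  -- Chosen so that `v i * v k * (r i / r k)` is the weighted geometric mean of `v i ^ 2` and `v k ^
  -- 2`. The value at `v i = 0` only has to be positive, as the required bound is then trivial.
  let r : Fin d → ℝ := fun i => if v i = 0 then 1 else v i ^ (2 * θ - 1)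
  have hpos : ∀ i, v i ≠ 0 → 0 < v i := fun i h => lt_of_le_of_ne (hv i) h.symm
  have hr : ∀ i, 0 < r i := fun i => by
    simp only [r]
    split_ifs with h
    · exact one_pos
    · exact Real.rpow_pos_of_pos (hpos i h) _
  refine isSeparable_schmidtForm hB hr fun i k hik => ?_
  refine le_trans ?_ (schmidt_diagonal_bound hp hq hsum i k hik)
  rw [hoff i k hik]
  by_cases hi : v i = 0
  · simp only [hi]
    simp
    positivity
  by_cases hk : v k = 0
  · simp only [hk]
    simp
    positivity
  have hi' := hpos i hi
  have hk' := hpos k hk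
  have e : v i * v k * (r i / r k) = (v i ^ 2) ^ θ * (v k ^ 2) ^ (1 - θ) := by
    simp only [r, if_neg hi, if_neg hk]
    have e1 : v i * v i ^ (2 * θ - 1) = (v i ^ 2) ^ θ := by
      rw [← Real.rpow_natCast, ← Real.rpow_mul hi'.le]
      nth_rw 1 [← Real.rpow_one (v i)]
      rw [← Real.rpow_add hi']
      congr 1
      push_cast
      ring
    have e2 : v k / v k ^ (2 * θ - 1) = (v k ^ 2) ^ (1 - θ) := by
      rw [← Real.rpow_natCast, ← Real.rpow_mul hk'.le]
      nth_rw 1 [← Real.rpow_one (v k)]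
      rw [← Real.rpow_sub hk']
      congr 1
      push_cast
      ring
    rw [← e1, ← e2]
    ring
  have hamgm := Real.geom_mean_le_arith_mean2_weighted hθ0 hθ1 (sq_nonneg (v i))
    (sq_nonneg (v k)) (by ring)
  calc |p * q| * (v i * v k) * (r i / r k) = |p * q| * (v i * v k * (r i / r k)) := by ring
    _ ≤ (α + β) * (θ * v i ^ 2 + (1 - θ) * v k ^ 2) := by
        rw [e]
        exact mul_le_mul hg hamgm (by positivity) (by positivity)
    _ = α * v i ^ 2 + β * v k ^ 2 := by
        linear_combination (v i ^ 2 - v k ^ 2) * hθα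

/-- The maps are unital, so inputs `X ⊗ 1` and `1 ⊗ X` recover local positivity from a block of the
output; the maximally entangled state, tested on its own vector, gives the third condition. -/
theorem isPositiveMap_localDepolarizing_iff (hd : 2 ≤ d) (p q : ℝ) :
    IsPositiveMap (localDepolarizing d p q) ↔ IsPositiveMap (depolarizing d p) ∧
      IsPositiveMap (depolarizing d q) ∧ -1 ≤ ((d : ℝ) ^ 2 - 1) * p * q := by
  have hd' : (2 : ℝ) ≤ d := by exact_mod_cast hd
  have hd0 : (d : ℂ) ≠ 0 := by norm_cast; omega
  have h1 : ∀ q : ℝ, depolarizing d q 1 = 1 := fun q => by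
    rw [depolarizing_apply, trace_one, Fintype.card_fin, smul_smul, div_mul_cancel₀ _ hd0,
      ← add_smul]
    simp
  constructor
  · intro h
    refine ⟨fun X hX => ?_, fun X hX => ?_, ?_⟩
    · have := h _ (hX.kronecker PosSemidef.one)
      rw [localDepolarizing, tensorMap_kronecker, h1] at this
      convert this.submatrix (fun i => (i, (⟨0, by omega⟩ : Fin d))) using 1
      ext i j
      simp
    · have := h _ (PosSemidef.one.kronecker hX)
      rw [localDepolarizing, tensorMap_kronecker, h1] at this
      convert this.submatrix (fun i => ((⟨0, by omega⟩ : Fin d), i)) using 1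
      ext i j
      simp
    · let v : Fin d → ℝ := fun _ => (√d)⁻¹
      have hv : ∀ i, v i ^ 2 = (d : ℝ)⁻¹ := fun i => by
        simp [v, inv_pow, Real.sq_sqrt (show (0 : ℝ) ≤ d by linarith)]
      have hsum : ∑ i, v i ^ 2 = 1 := by
        simp only [hv, Finset.sum_const, Finset.card_univ, Fintype.card_fin, nsmul_eq_mul]
        exact mul_inv_cancel₀ (by linarith)
      have := h _ (posSemidef_vecMulVec_self_star (schmidtVector v))
      rw [localDepolarizing_schmidtVector p q hsum] at this
      have h2 := (this.submatrix fun i => (i, i)).dotProduct_mulVec_nonneg (fun _ => 1)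
      have h3 : star (fun _ => 1 : Fin d → ℂ) ⬝ᵥ
          (((schmidtOutput p q v).submatrix (fun i => (i, i)) (fun i => (i, i))) *ᵥ fun _ => 1) =
          ((∑ i, ∑ j, ((if i = j then (p * ((1 - q) / d) + q * ((1 - p) / d)) * v i ^ 2 +
            (1 - p) / d * ((1 - q) / d) else 0) + p * q * (v i * v j)) : ℝ) : ℂ) := by
        simp [dotProduct, mulVec, schmidtOutput, schmidtForm, vecMulVec_apply, diagonal_apply]
      rw [h3] at h2
      have h4 : 0 ≤ ∑ i : Fin d, ∑ j : Fin d,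
          ((if i = j then (p * ((1 - q) / d) + q * ((1 - p) / d)) * v i ^ 2 +
            (1 - p) / d * ((1 - q) / d) else 0) + p * q * (v i * v j)) := by
        exact_mod_cast h2
      have hvv : ∀ i j, v i * v j = (d : ℝ)⁻¹ := fun i j => by
        rw [← hv i]; simp only [v]; ring
      simp only [Finset.sum_add_distrib, Finset.sum_ite_eq, Finset.mem_univ, if_true, hv, hvv,
        Finset.sum_const, Finset.card_univ, Fintype.card_fin, nsmul_eq_mul] at h4
      rw [← max_entangled_condition_iff hd]
      have e : (d : ℝ) * ((p * ((1 - q) / d) + q * ((1 - p) / d)) * (d : ℝ)⁻¹) +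
          d * ((1 - p) / d * ((1 - q) / d)) + d * (d * (p * q * (d : ℝ)⁻¹)) =
          d * ((1 - p) / d * ((1 - q) / d) +
            (p * ((1 - q) / d) + q * ((1 - p) / d)) / d + p * q) := by
        field_simp
        ring
      rw [e] at h4
      have := nonneg_of_mul_nonneg_right h4 (by linarith)
      linarith
  · rintro ⟨hp, hq, hpq⟩ X hX
    rw [isPositiveMap_depolarizing_iff hd, depolarizing_bounds_iff hd] at hp hq
    refine cone_of_unit_vectors PosSemidef.zero (fun _ _ => PosSemidef.add)
      (fun t X ht hX => hX.smul (by exact_mod_cast ht)) _ (fun u hu => ?_) hX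
    obtain ⟨U, V, v, hv, hsum, e⟩ := exists_localDepolarizing_eq_conj p q hu
    rw [e]
    exact (posSemidef_schmidtOutput hd hp hq hpq hv hsum).mul_mul_conjTranspose_same _

theorem annihilation_condition_of_posSemidef_partialTranspose (hd : 2 ≤ d) {p q : ℝ}
    (h : ∀ R : Op (Fin d × Fin d), IsState R →
      (partialTranspose (Fin d) (Fin d) (localDepolarizing d p q R)).PosSemidef) :
    ((d : ℝ) ^ 2 + 2 * d - 2) * p * q ≤ 2 + ((d : ℝ) - 2) * (p + q) := by
  let i : Fin d := ⟨0, by omega⟩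
  let k : Fin d := ⟨1, by omega⟩
  have hik : i ≠ k := by simp [i, k]
  let v : Fin d → ℝ := fun j => if j = i ∨ j = k then (√2)⁻¹ else 0
  have hvi : v i = (√2)⁻¹ := by simp [v]
  have hvk : v k = (√2)⁻¹ := by simp [v]
  have h2 : ((√2)⁻¹ : ℝ) ^ 2 = 1 / 2 := by simp [inv_pow]
  have hsum : ∑ j, v j ^ 2 = 1 := by
    rw [← Finset.sum_subset (Finset.subset_univ {i, k}), Finset.sum_pair hik, hvi, hvk, h2]
    · norm_num
    · intro x _ hx
      simp only [Finset.mem_insert, Finset.mem_singleton] at hx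
      simp [v, hx]
  have htr : (vecMulVec (schmidtVector v) (star (schmidtVector v))).trace = 1 := by
    rw [trace_vecMulVec]
    have : schmidtVector v ⬝ᵥ star (schmidtVector v) = ((∑ i, v i ^ 2 : ℝ) : ℂ) := by
      simp [dotProduct, Fintype.sum_prod_type, schmidtVector, sq]
    rw [this, hsum, Complex.ofReal_one]
  -- Partial transposition moves the coherence between `|ii⟩` and `|kk⟩` to `|ik⟩`, `|ki⟩`, where
  -- the antisymmetric vector detects it.
  have hpt := posSemidef_sub_nonneg (h _ ⟨posSemidef_vecMulVec_self_star (schmidtVector v), htr⟩)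
    (i, k) (k, i)
  rw [localDepolarizing_schmidtVector p q hsum] at hpt
  simp only [partialTranspose_apply, schmidtOutput, schmidtForm, Matrix.of_apply,
    Matrix.add_apply, Matrix.smul_apply, vecMulVec_apply, diagonal_apply_ne _ hik,
    diagonal_apply_ne _ hik.symm, hvi, hvk, h2, smul_eq_mul, Prod.mk.injEq] at hpt
  simp only [hik, hik.symm, and_self, if_true, if_false, ne_eq, not_false_eq_true,
    not_true_eq_false, zero_add, add_zero] at hpt
  have hreal : 0 ≤ (p * ((1 - q) / d) * (1 / 2) + q * ((1 - p) / d) * (1 / 2) +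
      (1 - p) / d * ((1 - q) / d)) + (p * ((1 - q) / d) * (1 / 2) + q * ((1 - p) / d) * (1 / 2) +
      (1 - p) / d * ((1 - q) / d)) - p * q * ((√2)⁻¹ * (√2)⁻¹) - p * q * ((√2)⁻¹ * (√2)⁻¹) := by
    exact_mod_cast hpt
  rw [← sq, h2] at hreal
  rw [← annihilation_condition_iff hd]
  linarith

theorem isEntanglementAnnihilating_iff (hd : 2 ≤ d) (p q : ℝ) :
    IsEntanglementAnnihilating (localDepolarizing d p q) ↔
      IsPositiveMap (localDepolarizing d p q) ∧
      ((d : ℝ) ^ 2 + 2 * d - 2) * p * q ≤ 2 + ((d : ℝ) - 2) * (p + q) := by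
  refine and_congr_right fun hpos => ⟨fun h => ?_, fun h R hR => ?_⟩
  · exact annihilation_condition_of_posSemidef_partialTranspose hd
      fun R hR => (h R hR).posSemidef_partialTranspose
  · obtain ⟨hp, hq, hpq⟩ := (isPositiveMap_localDepolarizing_iff hd p q).1 hpos
    rw [isPositiveMap_depolarizing_iff hd, depolarizing_bounds_iff hd] at hp hq
    refine cone_of_unit_vectors IsSeparable.zero (fun _ _ => IsSeparable.add)
      (fun t X ht hX => hX.smul ht) _ (fun u hu => ?_) hR.1
    obtain ⟨U, V, v, hv, hsum, e⟩ := exists_localDepolarizing_eq_conj p q hu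
    rw [e]
    exact (isSeparable_schmidtOutput hd hp hq hpq h hv hsum).conj U V

theorem isPPTInducing_of_isEntanglementAnnihilating {m n : Type} [Fintype m] [DecidableEq m]
    [Fintype n] [DecidableEq n] {Φ : Op (m × n) →ₗ[ℂ] Op (m × n)}
    (h : IsEntanglementAnnihilating Φ) : IsPPTInducing Φ := by
  intro X hX
  rw [LinearMap.comp_apply]
  by_cases hX0 : X = 0
  · rw [hX0, map_zero, map_zero]
    exact PosSemidef.zero
  have htr0 : X.trace ≠ 0 := fun h0 => hX0 (hX.trace_eq_zero_iff.1 h0)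
  have htr : 0 ≤ X.trace⁻¹ := inv_nonneg.2 hX.trace_nonneg
  have hs := (h.2 (X.trace⁻¹ • X) ⟨hX.smul htr, by
    rw [trace_smul, smul_eq_mul, inv_mul_cancel₀ htr0]⟩).posSemidef_partialTranspose
  have := hs.smul hX.trace_nonneg
  rwa [← map_smul, ← map_smul, smul_smul, mul_inv_cancel₀ htr0, one_smul] at this

theorem symmetric_condition_iff (hd : 2 ≤ d) (q : ℝ) :
    ((d : ℝ) ^ 2 + 2 * d - 2) * q * q ≤ 2 + ((d : ℝ) - 2) * (q + q) ↔
      -((√3 - 1) / ((d : ℝ) + 1 - √3)) ≤ q ∧ q ≤ (1 + √3) / ((d : ℝ) + 1 + √3) := by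
  have hd' : (2 : ℝ) ≤ d := by exact_mod_cast hd
  have h3 : √3 * √3 = (3 : ℝ) := Real.mul_self_sqrt (by norm_num)
  have h3' : 1 ≤ √3 := by nlinarith [Real.sqrt_nonneg 3]
  have h3'' : √3 ≤ 2 := by nlinarith [Real.sqrt_nonneg 3]
  have hA : 0 < (d : ℝ) + 1 - √3 := by linarith
  have hB : 0 < (d : ℝ) + 1 + √3 := by linarith
  rw [← neg_div, div_le_iff₀ hA, le_div_iff₀ hB]
  -- The leading coefficient is `(d+1)² - 3`, which is why `√3` splits the quadratic.
  have e : ((d : ℝ) ^ 2 + 2 * d - 2) * q * q - (2 + ((d : ℝ) - 2) * (q + q)) =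
      (q * (d + 1 + √3) - (1 + √3)) * (q * (d + 1 - √3) + (√3 - 1)) := by
    linear_combination (q * q - 2 * q + 1) * h3
  rw [← sub_nonpos, e]
  -- The negative root lies below the positive one, which excludes one sign pattern of the two
  -- factors.
  have hlt : q * (d + 1 + √3) - (1 + √3) ≤ 0 ∨ 0 < q * (d + 1 - √3) + (√3 - 1) := by
    by_contra! hc
    have hq : 0 < q := by
      by_contra! hq
      nlinarith [mul_nonneg_of_nonpos_of_nonpos hq (neg_nonpos.2 hB.le)]
    nlinarith [mul_pos hq hA]
  constructor
  · intro h
    constructor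
    · by_contra! hc
      rcases hlt with h1 | h1
      · have : q < 0 := by
          by_contra! hq
          nlinarith [mul_nonneg hq hA.le]
        have h2 : q * (d + 1 + √3) - (1 + √3) < 0 := by nlinarith [mul_neg_of_neg_of_pos this hB]
        nlinarith [mul_pos_of_neg_of_neg h2 (show q * (d + 1 - √3) + (√3 - 1) < 0 by linarith)]
      · linarith
    · by_contra! hc
      rcases hlt with h1 | h1
      · linarith
      · nlinarith [mul_pos (show 0 < q * (d + 1 + √3) - (1 + √3) by linarith) h1]
  · rintro ⟨h1, h2⟩
    exact mul_nonpos_of_nonpos_of_nonneg (by linarith) (by linarith)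

theorem isPositiveMap_localDepolarizing_self (hd : 2 ≤ d) {q : ℝ}
    (h : IsPositiveMap (depolarizing d q)) : IsPositiveMap (localDepolarizing d q q) := by
  have hd' : (2 : ℝ) ≤ d := by exact_mod_cast hd
  refine (isPositiveMap_localDepolarizing_iff hd q q).2 ⟨h, h, ?_⟩
  have : 0 ≤ ((d : ℝ) ^ 2 - 1) * (q * q) := mul_nonneg (by nlinarith) (mul_self_nonneg q)
  linarith

/-- The interval between the two roots lies inside the positivity range, so the symmetric criterion
needs no separate positivity condition. -/
theorem isPositiveMap_depolarizing_of_symmetric (hd : 2 ≤ d) {q : ℝ}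
    (h : -((√3 - 1) / ((d : ℝ) + 1 - √3)) ≤ q ∧ q ≤ (1 + √3) / ((d : ℝ) + 1 + √3)) :
    IsPositiveMap (depolarizing d q) := by
  have hd' : (2 : ℝ) ≤ d := by exact_mod_cast hd
  have h3 : √3 * √3 = (3 : ℝ) := Real.mul_self_sqrt (by norm_num)
  have h3' : 1 ≤ √3 := by nlinarith [Real.sqrt_nonneg 3]
  have h3'' : √3 ≤ 2 := by nlinarith [Real.sqrt_nonneg 3]
  refine (isPositiveMap_depolarizing_iff hd q).2 ⟨le_trans (neg_le_neg ?_) h.1, h.2.trans ?_⟩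
  · rw [div_le_div_iff₀ (by linarith) (by linarith)]
    nlinarith
  · rw [div_le_one (by linarith)]
    linarith

theorem isEntanglementAnnihilating_self_iff (hd : 2 ≤ d) (q : ℝ) :
    IsEntanglementAnnihilating (localDepolarizing d q q) ↔
      -((√3 - 1) / ((d : ℝ) + 1 - √3)) ≤ q ∧ q ≤ (1 + √3) / ((d : ℝ) + 1 + √3) := by
  rw [isEntanglementAnnihilating_iff hd, symmetric_condition_iff hd]
  exact ⟨fun h => h.2, fun h => ⟨isPositiveMap_localDepolarizing_self hd
    (isPositiveMap_depolarizing_of_symmetric hd h), h⟩⟩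

/-- Necessity uses only the two-level test state, and sufficiency passes through separability, so
PPT-inducing and annihilating coincide on the diagonal `p = q`. -/
theorem isPPTInducing_self_iff (hd : 2 ≤ d) (q : ℝ) :
    IsPPTInducing (localDepolarizing d q q) ↔
      -((√3 - 1) / ((d : ℝ) + 1 - √3)) ≤ q ∧ q ≤ (1 + √3) / ((d : ℝ) + 1 + √3) := by
  refine ⟨fun h => ?_, fun h => isPPTInducing_of_isEntanglementAnnihilating
    ((isEntanglementAnnihilating_self_iff hd q).2 h)⟩
  rw [← symmetric_condition_iff hd]
  exact annihilation_condition_of_posSemidef_partialTranspose hd fun R hR => h R hR.1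

theorem isPositiveMap_localDepolarizing_of_completelyPositive (hd : 2 ≤ d) {p q : ℝ}
    (hp : -(1 / ((d : ℝ) ^ 2 - 1)) ≤ p) (hp1 : p ≤ 1)
    (hq : -(1 / ((d : ℝ) ^ 2 - 1)) ≤ q) (hq1 : q ≤ 1) :
    IsPositiveMap (localDepolarizing d p q) := by
  have hd' : (2 : ℝ) ≤ d := by exact_mod_cast hd
  have hlow : -(1 / ((d : ℝ) - 1)) ≤ -(1 / ((d : ℝ) ^ 2 - 1)) :=
    neg_le_neg (one_div_le_one_div_of_le (by linarith) (by nlinarith))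
  refine (isPositiveMap_localDepolarizing_iff hd p q).2
    ⟨(isPositiveMap_depolarizing_iff hd p).2 ⟨hlow.trans hp, hp1⟩,
      (isPositiveMap_depolarizing_iff hd q).2 ⟨hlow.trans hq, hq1⟩, ?_⟩
  have hD : 0 < (d : ℝ) ^ 2 - 1 := by nlinarith
  rw [← neg_div, div_le_iff₀ hD] at hp hq
  -- Only opposite signs matter: the nonnegative parameter is at most 1 and the negative one at
  -- least `-1/(d²-1)`.
  rcases le_or_gt 0 p with h | h
  · rcases le_or_gt 0 q with h' | h'
    · have : 0 ≤ ((d : ℝ) ^ 2 - 1) * p * q := by positivity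
      linarith
    · nlinarith
  · rcases le_or_gt 0 q with h' | h'
    · nlinarith
    · have : 0 ≤ ((d : ℝ) ^ 2 - 1) * (p * q) :=
        mul_nonneg hD.le (mul_nonneg_of_nonpos_of_nonpos h.le h'.le)
      linarith

theorem symmetric_lower_bound (hd : 2 ≤ d) {q : ℝ} (hq : -(1 / ((d : ℝ) ^ 2 - 1)) ≤ q) :
    -((√3 - 1) / ((d : ℝ) + 1 - √3)) ≤ q := by
  have hd' : (2 : ℝ) ≤ d := by exact_mod_cast hd
  have h3 : √3 * √3 = (3 : ℝ) := Real.mul_self_sqrt (by norm_num)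
  have h3' : 3 / 2 ≤ √3 := by nlinarith [Real.sqrt_nonneg 3]
  have h3'' : √3 ≤ 2 := by nlinarith [Real.sqrt_nonneg 3]
  refine (neg_le_neg ?_).trans hq
  rw [div_le_div_iff₀ (by nlinarith) (by linarith)]
  nlinarith

end Characterization

end Depolarizing

theorem mainTheorem3 (d : ℕ) (hd : 2 ≤ d) :
    -- the positivity conditions
    (∀ q : ℝ, Depolarizing.IsPositiveMap (Depolarizing.depolarizing d q) ↔
      -(1 / ((d : ℝ) - 1)) ≤ q ∧ q ≤ 1) ∧
    (∀ q₁ q₂ : ℝ, Depolarizing.IsPositiveMap (Depolarizing.localDepolarizing d q₁ q₂) ↔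
      Depolarizing.IsPositiveMap (Depolarizing.depolarizing d q₁) ∧
      Depolarizing.IsPositiveMap (Depolarizing.depolarizing d q₂) ∧
      -1 ≤ ((d : ℝ) ^ 2 - 1) * q₁ * q₂) ∧
    -- the general characterization
    (∀ q₁ q₂ : ℝ,
      Depolarizing.IsEntanglementAnnihilating (Depolarizing.localDepolarizing d q₁ q₂) ↔
      Depolarizing.IsPositiveMap (Depolarizing.localDepolarizing d q₁ q₂) ∧
      ((d : ℝ) ^ 2 + 2 * d - 2) * q₁ * q₂ ≤ 2 + ((d : ℝ) - 2) * (q₁ + q₂)) ∧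
    -- in the complete positivity range of both local maps
    (∀ q₁ q₂ : ℝ, -(1 / ((d : ℝ) ^ 2 - 1)) ≤ q₁ → q₁ ≤ 1 →
      -(1 / ((d : ℝ) ^ 2 - 1)) ≤ q₂ → q₂ ≤ 1 →
      (Depolarizing.IsEntanglementAnnihilating (Depolarizing.localDepolarizing d q₁ q₂) ↔
      ((d : ℝ) ^ 2 + 2 * d - 2) * q₁ * q₂ ≤ 2 + ((d : ℝ) - 2) * (q₁ + q₂))) ∧
    -- the symmetric case
    (∀ q : ℝ, ((d : ℝ) ^ 2 + 2 * d - 2) * q * q ≤ 2 + ((d : ℝ) - 2) * (q + q) ↔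
      -((√3 - 1) / ((d : ℝ) + 1 - √3)) ≤ q ∧ q ≤ (1 + √3) / ((d : ℝ) + 1 + √3)) ∧
    (∀ q : ℝ,
      Depolarizing.IsEntanglementAnnihilating (Depolarizing.localDepolarizing d q q) ↔
      -((√3 - 1) / ((d : ℝ) + 1 - √3)) ≤ q ∧ q ≤ (1 + √3) / ((d : ℝ) + 1 + √3)) ∧
    (∀ q : ℝ, Depolarizing.IsPositiveMap (Depolarizing.depolarizing d q) →
      (Depolarizing.IsPPTInducing (Depolarizing.localDepolarizing d q q) ↔
      -((√3 - 1) / ((d : ℝ) + 1 - √3)) ≤ q ∧ q ≤ (1 + √3) / ((d : ℝ) + 1 + √3))) ∧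
    -- the symmetric case in the complete positivity range
    (∀ q : ℝ, -(1 / ((d : ℝ) ^ 2 - 1)) ≤ q → q ≤ 1 →
      (Depolarizing.IsEntanglementAnnihilating (Depolarizing.localDepolarizing d q q) ↔
        q ≤ (1 + √3) / ((d : ℝ) + 1 + √3)) ∧
      (Depolarizing.IsPPTInducing (Depolarizing.localDepolarizing d q q) ↔
        q ≤ (1 + √3) / ((d : ℝ) + 1 + √3))) := by
  refine ⟨Depolarizing.isPositiveMap_depolarizing_iff hd,
    Depolarizing.isPositiveMap_localDepolarizing_iff hd,
    Depolarizing.isEntanglementAnnihilating_iff hd, fun q₁ q₂ h₁ h₁' h₂ h₂' => ?_,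
    Depolarizing.symmetric_condition_iff hd, Depolarizing.isEntanglementAnnihilating_self_iff hd,
    fun q _ => Depolarizing.isPPTInducing_self_iff hd q, fun q h _ => ⟨?_, ?_⟩⟩
  · rw [Depolarizing.isEntanglementAnnihilating_iff hd]
    exact and_iff_right
      (Depolarizing.isPositiveMap_localDepolarizing_of_completelyPositive hd h₁ h₁' h₂ h₂')
  · rw [Depolarizing.isEntanglementAnnihilating_self_iff hd]
    exact and_iff_right (Depolarizing.symmetric_lower_bound hd h)
  · rw [Depolarizing.isPPTInducing_self_iff hd]
    exact and_iff_right (Depolarizing.symmetric_lower_bound hd h)
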